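/- **Setting.** Let $A$ be a nonempty countable alphabet with a fixed enumeration $\{1,2,\dots\}$ (finite or infinite), $A^{-\mathbb N}$ the set of pasts $\underline a=\ldots a_{-2}a_{-1}$, and $P$ a kernel: $P(a|\underline a)\in[0,1]$ with $\sum_{a}P(a|\underline a)=1$ for every $\underline a$. For a finite string $w$, $\inf_{\underline z}P(a|w\underline z)$ is the infimum over all pasts that end with $w$ (in $vw\underline z$ the string $v$ is the most recent one). Put $\alpha(a)=\inf_{\underline z}P(a|\underline z)$, $\alpha_{-1}=\sum_a\alpha(a)$, and assume $\alpha_{-1}>0$. Let $\mathbf U=(U_i)_{i\in\mathbb Z}$ be i.i.d. uniform on $[0,1[$. A *context tree* is a set $\tau$ of finite or infinite strings, none a proper suffix of another, such that every past $\underline a$ has exactly one suffix $c_\tau(\underline a)$ in $\tau$. It is a *skeleton* if it is $\{\emptyset\}$ or the smallest context tree containing its own infinite contexts. For finite $v\in\tau$ let $\alpha_k^v=\inf_{w\in A^k}\sum_a\inf_{\underline z}P(a|v\,w\,\underline z)$, and let $\alpha_k^i=\inf\{\alpha_k^v: v\in\tau \text{ finite},\ |v|\le i\}$. $P$ is *locally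 continuous* w.r.t. $\tau$ if $\alpha_k^v\to1$ as $k\to\infty$ for every finite $v\in\tau$. Let $Y_i=a$ if $\sum_{j<a}\alpha(j)\le U_i<\sum_{j\le a}\alpha(j)$ and $Y_i=\star$ if $U_i\ge\alpha_{-1}$. Let $c_\tau^n$ be the supremum of $|c_\tau(\cdot)|$ over all pasts obtained from $Y_{-\infty}^n$ by replacing each $\star$ by an arbitrary symbol. Let $\bar\theta[0]$ be the supremum of the times $i\le0$ such that, for each $j=i,\dots,0$, $Y_j\in A$ or $c_\tau^{j-1}\le j-i$. The skeleton is *good* if $\mathbb E|\bar\theta[0]|<\infty$. Put $A_0=\alpha_{-1}$ and $$A_k=\Big\{1-(\mathbb E|\bar\theta[0]|+1)\,\mathbb P\big(U_0>\alpha_k^{c_\tau^{-1}}\big)\Big\}\vee\alpha_{-1},\qquad k\ge1 .$$ A sequence $c_n\ge0$ decays exponentially if $c_n\le Dd^n$ for all $n$, for some $D>0$, $0<d<1$; $W$ has exponential tail if $\mathbb P(|W|\ge n)$ decays exponentially. **The chain.** For each past $\underline a$ partition $[0,1[$ into consecutive intervals $I_0(b)$, then $I_1(b|a_{-1})$, $I_2(b|a_{-2}^{-1})$,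 …, and last $I_\infty(b|\underline a)$ ($b\in A$, at each level in the order of $A$), of lengths $\alpha(b)$, $\inf_{\underline z}P(b|a_{-k}^{-1}\underline z)-\inf_{\underline z}P(b|a_{-k+1}^{-1}\underline z)$ for $k\ge1$, and $P(b|\underline a)-\lim_k\inf_{\underline z}P(b|a_{-k}^{-1}\underline z)$. The update function $F(\underline a,u)$ is the symbol $b$ one of whose intervals contains $u$. Let $F_{[j,i]}(\underline a,U_j^i)$ be the symbol at time $i$ obtained by applying $F$ successively at times $j,\dots,i$ from the past $\underline a$. Let $\theta[m,n]$ ($m\le n\le+\infty$) be the largest $j\le m$ such that no $F_{[j,i]}(\underline a,U_j^i)$, $m\le i\le n$ ($i$ finite), depends on $\underline a$; let $\theta[i]=\theta[i,i]$ and $X_i=\Phi(\mathbf U)_i=F_{[\theta[i],i]}(\underline a,U_{\theta[i]}^i)$. A time $t$ is a *regeneration time* if $\theta[t,+\infty]=t$. **Statement.** Let $P$ be locally continuous w.r.t. the good skeleton $\tau$, with $\alpha_{-1}>0$, and assume either - (ii) $\sum_{k\ge0}(1-A_k)<\infty$, or - (iii) $\bar\theta[0]$ has exponential tail and $(1-A_k)_{k\ge0}$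 decays exponentially. Then almost surely the regeneration times form a doubly infinite sequence $\dots<T_{-1}<T_0\le0<T_1<\dots$; the increments $(T_{i+1}-T_i)_{i\in\mathbb Z}$ are independent, and identically distributed for $i\ne0$; the strings $(X_{T_i},\dots,X_{T_{i+1}-1})_{i\ne0}$ are i.i.d. and have finite expected length. Under (iii) the lengths of these strings have exponential tail. -/

import Mathlib

open MeasureTheory ProbabilityTheory Filter
open scoped ENNReal Topology

namespace PerfectSimulation

noncomputable section

/-! ### Pasts, finite strings, kernels

Time runs backwards inside a string: the entry with index `n` of a past `x : ℕ → A` is the symbol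
`a_{-(n+1)}`, and the head of a finite string is its most recent symbol. -/

/-- The infinite pasts `… a_{-2} a_{-1}`; `x n` is the symbol at time `-(n+1)`. -/
abbrev Past (A : Type*) := ℕ → A

/-- A transition probability kernel: `P x a` is `P(a | x)`, and `∑ a, P x a = 1` for every `x`. -/
abbrev Ker (A : Type*) := Past A → PMF A

/-- The past whose most recent symbols are those of `w`, preceded (in time) by the past `z`. -/
def glue {A : Type*} (w : List A) (z : Past A) : Past A :=
  fun n => if h : n < w.length then w[n] else z (n - w.length)

/-- The string of the `k` most recent symbols of a past. -/
def recent {A : Type*} (x : Past A) (k : ℕ) : List A := List.ofFn fun i : Fin k => x i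

/-- The past `x` followed (in time) by the symbol `a`. -/
def snoc {A : Type*} (x : Past A) (a : A) : Past A
  | 0 => a
  | n + 1 => x n

/-- `inf_z P(a | w z)`: the infimum over all pasts that end with the string `w`. -/
def infProb {A : Type*} (P : Ker A) (w : List A) (a : A) : ℝ≥0∞ := ⨅ z : Past A, P (glue w z) a

/-- `α(a) = inf_z P(a | z)`. -/
def alphaSym {A : Type*} (P : Ker A) (a : A) : ℝ≥0∞ := ⨅ z : Past A, P z a

/-- `α_{-1} = ∑ a, α(a)`. -/
def alphaNeg {A : Type*} (P : Ker A) : ℝ≥0∞ := ∑' a, alphaSym P a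

/-- Weak non-nullness. -/
def WeaklyNonNull {A : Type*} (P : Ker A) : Prop := 0 < alphaNeg P

/-! ### Context trees and skeletons -/

/-- Finite or infinite strings of past symbols. -/
abbrev Str (A : Type*) := List A ⊕ Past A

/-- The length of a finite or infinite string. -/
def Str.len {A : Type*} : Str A → ℕ∞
  | Sum.inl w => (w.length : ℕ∞)
  | Sum.inr _ => ⊤

/-- `v` is a suffix of the past `x`, i.e. `v` consists of the most recent symbols of `x`. -/
def Str.SuffixOfPast {A : Type*} (v : Str A) (x : Past A) : Prop :=
  match v with
  | Sum.inl w => recent x w.length = w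
  | Sum.inr y => y = x

/-- `v` is a (not necessarily proper) suffix of the string `v'`.
Most recent symbols come first, so for finite strings this is the prefix order of lists. -/
def Str.SuffixOf {A : Type*} (v v' : Str A) : Prop :=
  match v' with
  | Sum.inr x => v.SuffixOfPast x
  | Sum.inl w' =>
    match v with
    | Sum.inl w => w <+: w'
    | Sum.inr _ => False

/-- A context tree: every infinite past has exactly one suffix in `τ`, and no element of `τ` is a
proper suffix of another one. -/
structure IsContextTree {A : Type*} (τ : Set (Str A)) : Prop where
  partition : ∀ x : Past A, ∃! v : Str A, v ∈ τ ∧ v.SuffixOfPast x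
  suffix_free : ∀ v ∈ τ, ∀ v' ∈ τ, v.SuffixOf v' → v = v'

/-- The tree order: `τ` is smaller than `τ'` if every context of `τ'` ends with a context of `τ`. -/
def TreeLE {A : Type*} (τ τ' : Set (Str A)) : Prop := ∀ v' ∈ τ', ∃ v ∈ τ, v.SuffixOf v'

/-- A skeleton: either the tree reduced to the empty context, or a context tree that is the
smallest one among the context trees containing all its infinite contexts. -/
def IsSkeleton {A : Type*} (τ : Set (Str A)) : Prop :=
  τ = {Sum.inl []} ∨
    (IsContextTree τ ∧ ∀ τ' : Set (Str A), IsContextTree τ' →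
      (∀ y : Past A, Sum.inr y ∈ τ → Sum.inr y ∈ τ') → TreeLE τ τ')

/-- `|c_τ(x)|`: the length of the (unique) context of `x` in the context tree `τ`. -/
def contextLen {A : Type*} (τ : Set (Str A)) (x : Past A) : ℕ∞ :=
  ⨅ v ∈ {v : Str A | v ∈ τ ∧ v.SuffixOfPast x}, v.len

/-! ### Local continuity -/

/-- `α_k^v = inf_{w ∈ A^k} ∑_a inf_z P(a | v w z)` for a finite string `v`. -/
def alphaStr {A : Type*} (P : Ker A) (v : List A) (k : ℕ) : ℝ≥0∞ :=
  ⨅ w ∈ {w : List A | w.length = k}, ∑' a, infProb P (v ++ w) a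

/-- `α_k^i`: the infimum of `α_k^v` over the finite contexts `v` of `τ` of length at most `i`. -/
def alphaLen {A : Type*} (P : Ker A) (τ : Set (Str A)) (k : ℕ) (i : ℕ∞) : ℝ≥0∞ :=
  ⨅ v ∈ {v : List A | Sum.inl v ∈ τ ∧ (v.length : ℕ∞) ≤ i}, alphaStr P v k

/-- `P` is locally continuous with respect to `τ`. -/
def LocallyContinuous {A : Type*} (P : Ker A) (τ : Set (Str A)) : Prop :=
  ∀ v : List A, Sum.inl v ∈ τ → Tendsto (fun k => alphaStr P v k) atTop (𝓝 1)

/-! ### Partitions of the unit interval -/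

/-- Consecutive half-open intervals, one for each symbol `b`, of lengths `hi b - lo b`, laid out in
the order of the enumeration of the alphabet and starting at the point `∑ c, lo c`. -/
def slot {A : Type*} [Encodable A] (lo hi : A → ℝ≥0∞) (b : A) : Set ℝ≥0∞ :=
  let left := (∑' c, lo c) + ∑' c, if Encodable.encode c < Encodable.encode b then hi c - lo c else 0
  Set.Ico left (left + (hi b - lo b))

open Classical in
/-- The value of `Y` when the uniform variable equals `u`: the symbol `a` if `u` is in the
interval of length `α(a)` attached to `a`, and `none` (the symbol `⋆`) if `u ≥ α_{-1}`. -/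
def spontaneous {A : Type*} [Encodable A] (P : Ker A) (u : ℝ) : Option A :=
  if h : ∃ a, ENNReal.ofReal u ∈ slot 0 (alphaSym P) a then some h.choose else none

/-! ### Good coalescence times -/

/-- The past `Y_{-∞}^n(a)`, in which every `⋆` of `Y` is replaced by the symbol of `a`. -/
def filledPast {A : Type*} [Encodable A] (P : Ker A) (u : ℤ → ℝ) (n : ℤ) (a : ℤ → A) : Past A :=
  fun k => (spontaneous P (u (n - k))).getD (a (n - k))

/-- `c_τ^n`, the maximum context length at time `n` given `Y`. -/
def maxContext {A : Type*} [Encodable A] (P : Ker A) (τ : Set (Str A)) (u : ℤ → ℝ) (n : ℤ) : ℕ∞ :=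
  ⨆ a : ℤ → A, contextLen τ (filledPast P u n a)

/-- The good coalescence times for time `m`: the times `i ≤ m` such that, for every time `j` from
`i` to `m`, either `Y_j` is a symbol or the context needed to choose the symbol at time `j` is
contained in the window from `i` to `j - 1`. -/
def goodTimes {A : Type*} [Encodable A] (P : Ker A) (τ : Set (Str A)) (u : ℤ → ℝ) (m : ℤ) : Set ℤ :=
  {i | i ≤ m ∧ ∀ j, i ≤ j → j ≤ m →
    (spontaneous P (u j)).isSome ∨ maxContext P τ u (j - 1) ≤ ((j - i).toNat : ℕ∞)}

/-- `|θ̄[0]|`, where `θ̄[0]` is the supremum of the good coalescence times for time `0`; it is `⊤`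
if there is none. -/
def absGood {A : Type*} [Encodable A] (P : Ker A) (τ : Set (Str A)) (u : ℤ → ℝ) : ℕ∞ :=
  ⨅ i ∈ goodTimes P τ u 0, (i.natAbs : ℕ∞)

/-- `E|θ̄[0]|`. -/
def meanGood {A Ω : Type*} [Encodable A] [MeasurableSpace Ω] (μ : Measure Ω) (U : ℤ → Ω → ℝ)
    (P : Ker A) (τ : Set (Str A)) : ℝ≥0∞ :=
  ∫⁻ ω, (absGood P τ fun i => U i ω : ℝ≥0∞) ∂μ

/-- The probabilistic skeleton of `P` on `τ` is good: `θ̄[0]` has finite expectation. -/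
def IsGood {A Ω : Type*} [Encodable A] [MeasurableSpace Ω] (μ : Measure Ω) (U : ℤ → Ω → ℝ)
    (P : Ker A) (τ : Set (Str A)) : Prop :=
  meanGood μ U P τ < ⊤

/-! ### The two regimes -/

/-- `A_0 = α_{-1}` and `A_k = {1 - (E|θ̄[0]| + 1) ℙ(U_0 > α_k^{c_τ^{-1}})} ∨ α_{-1}` for `k ≥ 1`.
The subtraction is truncated at `0`, which has no effect on the maximum. -/
def rate {A Ω : Type*} [Encodable A] [MeasurableSpace Ω] (μ : Measure Ω) (U : ℤ → Ω → ℝ)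
    (P : Ker A) (τ : Set (Str A)) : ℕ → ℝ≥0∞
  | 0 => alphaNeg P
  | k + 1 =>
    (1 - (meanGood μ U P τ + 1) *
      μ {ω | alphaLen P τ (k + 1) (maxContext P τ (fun i => U i ω) (-1))
        < ENNReal.ofReal (U 0 ω)}) ⊔ alphaNeg P

/-- Exponentially fast decay to zero. -/
def ExpDecay (c : ℕ → ℝ≥0∞) : Prop :=
  ∃ D d : ℝ, 0 < D ∧ 0 < d ∧ d < 1 ∧ ∀ n, c n ≤ ENNReal.ofReal (D * d ^ n)

/-- `∑_{k ≥ 0} (1 - A_k) < ∞`. -/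
def SummableRegime {A Ω : Type*} [Encodable A] [MeasurableSpace Ω] (μ : Measure Ω)
    (U : ℤ → Ω → ℝ) (P : Ker A) (τ : Set (Str A)) : Prop :=
  ∑' k, (1 - rate μ U P τ k) < ⊤

/-- `θ̄[0]` has exponential tail and `1 - A_k` decays exponentially fast to zero. -/
def ExponentialRegime {A Ω : Type*} [Encodable A] [MeasurableSpace Ω] (μ : Measure Ω)
    (U : ℤ → Ω → ℝ) (P : Ker A) (τ : Set (Str A)) : Prop :=
  ExpDecay (fun n => μ {ω | (n : ℕ∞) ≤ absGood P τ fun i => U i ω}) ∧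
    ExpDecay fun k => 1 - rate μ U P τ k

/-! ### The update function -/

/-- The part of the unit interval attached to the symbol `b` and the past `x`: the intervals
`I_0(b)`, `I_k(b | x_{-k}^{-1})` for `k ≥ 1`, and `I_∞(b | x)`, of lengths `α(b)`,
`inf_z P(b | x_{-k}^{-1} z) - inf_z P(b | x_{-k+1}^{-1} z)` and
`P(b | x) - lim_k inf_z P(b | x_{-k}^{-1} z)`. The intervals with smaller `k` come first. -/
def cell {A : Type*} [Encodable A] (P : Ker A) (x : Past A) (b : A) : Set ℝ≥0∞ :=
  slot 0 (alphaSym P) b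
    ∪ (⋃ k : ℕ, slot (infProb P (recent x k)) (infProb P (recent x (k + 1))) b)
    ∪ slot (fun c => ⨆ k : ℕ, infProb P (recent x k) c) (fun c => P x c) b

open Classical in
/-- The update function: `F(x, u)` is the symbol whose cell contains `u`. -/
def update {A : Type*} [Encodable A] [Nonempty A] (P : Ker A) (x : Past A) (u : ℝ) : A :=
  if h : ∃ b, ENNReal.ofReal u ∈ cell P x b then h.choose else Classical.arbitrary A

/-! ### Coupling from the past with a given update function -/

/-- The past `x F_{[j,j]}(x, u) … F_{[j,j+n-1]}(x, u)` obtained after `n` updates that start at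
time `j` from the past `x`. -/
def evolve {A : Type*} (F : Past A → ℝ → A) (u : ℤ → ℝ) (j : ℤ) (x : Past A) : ℕ → Past A
  | 0 => x
  | n + 1 => snoc (evolve F u j x n) (F (evolve F u j x n) (u (j + n)))

/-- `F_{[j,i]}(x, u_j^i)` for `j ≤ i`. -/
def iter {A : Type*} (F : Past A → ℝ → A) (u : ℤ → ℝ) (j i : ℤ) (x : Past A) : A :=
  F (evolve F u j x (i - j).toNat) (u i)

/-- The times `j ≤ m` such that the symbols constructed in the window from `m` to `n`, starting at
time `j`, do not depend on the past before time `j`. The coalescence time `θ[m,n]` is the greatest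
element of this set; `n = ⊤` stands for `n = +∞`. -/
def coalTimes {A : Type*} (F : Past A → ℝ → A) (u : ℤ → ℝ) (m : ℤ) (n : WithTop ℤ) : Set ℤ :=
  {j | j ≤ m ∧ ∀ i : ℤ, m ≤ i → (i : WithTop ℤ) ≤ n →
    ∀ x y : Past A, iter F u j i x = iter F u j i y}

/-- `t` is a regeneration time: `θ[t,+∞] = t`. -/
def IsRegenTime {A : Type*} (F : Past A → ℝ → A) (u : ℤ → ℝ) (t : ℤ) : Prop :=
  IsGreatest (coalTimes F u t ⊤) t

/-- The reconstruction function `[Φ(u)]_i = F_{[θ[i],i]}(x, u_{θ[i]}^i)`, with `θ[i] = θ[i,i]`. By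
the definition of `θ[i]` the value does not depend on `x` whenever `θ[i]` exists. -/
def reconstruct {A : Type*} [Nonempty A] (F : Past A → ℝ → A) (u : ℤ → ℝ) (i : ℤ) : A :=
  iter F u (sSup (coalTimes F u i (i : WithTop ℤ))) i (Classical.arbitrary (Past A))

/-- The string `X_s … X_{t-1}`, written from time `s` to time `t - 1`. -/
def stringBetween {A : Type*} (X : ℤ → A) (s t : ℤ) : List A :=
  List.ofFn fun k : Fin (t - s).toNat => X (s + (k : ℕ))

/-- The finite strings over a countable alphabet carry the discrete `σ`-algebra. -/
instance instMeasurableSpaceString {A : Type*} : MeasurableSpace (List A) := ⊤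

/-- `T` enumerates almost surely the regeneration times in increasing order, with
`T_0 ≤ 0 < T_1`. -/
def EnumeratesRegenTimes {A Ω : Type*} [MeasurableSpace Ω] (μ : Measure Ω) (U : ℤ → Ω → ℝ)
    (F : Past A → ℝ → A) (T : ℤ → Ω → ℤ) : Prop :=
  ∀ᵐ ω ∂μ, (∀ t : ℤ, IsRegenTime F (fun i => U i ω) t ↔ ∃ l : ℤ, T l ω = t) ∧
    (∀ l : ℤ, T l ω < T (l + 1) ω) ∧ T 0 ω ≤ 0 ∧ 0 < T 1 ω

/-- The increments of `T` are independent, and identically distributed for indices `i ≠ 0`. -/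
def IsRenewal {Ω : Type*} [MeasurableSpace Ω] (μ : Measure Ω) (T : ℤ → Ω → ℤ) : Prop :=
  iIndepFun (fun (i : ℤ) (ω : Ω) => T (i + 1) ω - T i ω) μ ∧
    ∀ i j : ℤ, i ≠ 0 → j ≠ 0 →
      IdentDistrib (fun ω => T (i + 1) ω - T i ω) (fun ω => T (j + 1) ω - T j ω) μ μ

/-- The string `(Φ(U)_{T_i}, …, Φ(U)_{T_{i+1} - 1})`. -/
def regenString {A Ω : Type*} [Nonempty A] (U : ℤ → Ω → ℝ) (F : Past A → ℝ → A) (T : ℤ → Ω → ℤ)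
    (i : ℤ) (ω : Ω) : List A :=
  stringBetween (reconstruct F fun n => U n ω) (T i ω) (T (i + 1) ω)

end

end PerfectSimulation

open PerfectSimulation

/-! A time `t` at which the symbols produced from `t` on forget the past is a regeneration time, and
whether `t` is one depends only on the uniform variables from `t` on. If `t + n` is a regeneration
time, then `t` is one if and only if the window `t, …, t + n - 1` coalesces, which depends only on
that window (`isRegenTime_iff_coalesces`). So the regeneration times form a stationary renewal
process, and the events "the strings between consecutive regeneration times from `t` on are
`w₁, …, w_n`" have probability `π(w₁) ⋯ π(w_n) p` with `p` the probability of a regeneration time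
(`seqLaw_startsWith`). Summing over the place of the time `0` inside the string of index `0` gives
the joint law of the strings (`Enumerates.seqLaw_cycleString`): they are independent, those with
index `i ≠ 0` have law `π`, and the one with index `0` has the size-biased law `|w| p π(w)`. That the
latter has mass one says that the mean length under `π` is `1 / p`. All this needs only that `p > 0`
and that almost surely there are regeneration times in both directions.

For this, call the time `t + n` safe from `t` if `Y` is a symbol there or if the context, as far as
`Y` determines it, and enough further symbols, as measured by `α_k^i`, lie in the window; if all
times from `t` on are safe, then `t` is a regeneration time (`isRegenTime_of_safe`). The probability
that the `n`-th time is not safe is bounded by the tails of `θ̄[0]` and by `1 - A_k` with `k = n / 2`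
(`seqLaw_unsafe_le`), so these probabilities are summable. Hence with positive probability all but
the first `N` times are safe, and turning each `⋆` among the first `N` values of `Y` into a symbol
keeps the later times safe; a contraction of the uniform variables does this and preserves null
sets (`seqLaw_alwaysSafe_pos`).

The first failure time of safety from `t` is determined by the window up to it, so that what follows
is independent. This gives a renewal inequality for the probability that none of the first `M` times
is always safe (`seqLaw_noAlwaysSafe_le`), which yields the existence of regeneration times and, in
the exponential regime, the exponential tail (`expDecay_of_renewal`).

Measurability is not automatic, since coalescence quantifies over uncountably many pasts and the
kernel need not be measurable in the past. It holds because any union of half-open intervals is a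
Borel set (`measurableSet_iUnion_Ico`). -/

namespace PerfectSimulation

/-! ### The cells of the update function -/

theorem slot_bounds {A : Type*} [Encodable A] {lo hi : A → ℝ≥0∞} (hle : lo ≤ hi) {b : A}
    {v : ℝ≥0∞} (hv : v ∈ slot lo hi b) : ∑' c, lo c ≤ v ∧ v < ∑' c, hi c := by
  obtain ⟨h1, h2⟩ := hv
  refine ⟨le_trans le_self_add h1, lt_of_lt_of_le h2 ?_⟩
  classical
  have e : ∑' c, hi c = ∑' c, lo c + ∑' c, (hi c - lo c) := by
    rw [← ENNReal.tsum_add]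
    exact tsum_congr fun c => (add_tsub_cancel_of_le (hle c)).symm
  rw [e, add_assoc]
  gcongr
  rw [← tsum_ite_eq b (fun c => hi c - lo c), ← ENNReal.tsum_add]
  refine ENNReal.tsum_le_tsum fun c => ?_
  by_cases hc : c = b
  · subst hc; simp
  · rw [if_neg hc, add_zero]; split_ifs <;> simp

theorem slot_unique {A : Type*} [Encodable A] {lo hi : A → ℝ≥0∞} {b b' : A}
    {v : ℝ≥0∞} (hv : v ∈ slot lo hi b) (hv' : v ∈ slot lo hi b') : b = b' := by
  classical
  have key : ∀ {b b' : A}, v ∈ slot lo hi b → v ∈ slot lo hi b' →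
      ¬ Encodable.encode b < Encodable.encode b' := by
    intro b b' hv hv' hlt
    refine absurd (lt_of_lt_of_le hv.2 ?_) (not_lt.2 hv'.1)
    rw [add_assoc]
    gcongr
    rw [← tsum_ite_eq b (fun c => hi c - lo c), ← ENNReal.tsum_add]
    refine ENNReal.tsum_le_tsum fun c => ?_
    by_cases hc : c = b
    · subst hc; simp [hlt]
    · rw [if_neg hc, add_zero]
      by_cases h : Encodable.encode c < Encodable.encode b
      · simp [h, h.trans hlt]
      · simp [h]
  exact Encodable.encode_injective (le_antisymm (not_lt.1 (key hv' hv)) (not_lt.1 (key hv hv')))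

theorem exists_mem_slot {A : Type*} [Encodable A] {lo hi : A → ℝ≥0∞} (hle : lo ≤ hi)
    {v : ℝ≥0∞} (h1 : ∑' c, lo c ≤ v) (h2 : v < ∑' c, hi c) : ∃ b, v ∈ slot lo hi b := by
  classical
  have e : ∑' c, hi c = ∑' c, lo c + ∑' c, (hi c - lo c) := by
    rw [← ENNReal.tsum_add]
    exact tsum_congr fun c => (add_tsub_cancel_of_le (hle c)).symm
  -- `G n` is the right end of the slots of the symbols with code less than `n`.
  set G : ℕ → ℝ≥0∞ := fun n => ∑' c, lo c +
    ∑' c, if Encodable.encode c < n then hi c - lo c else 0 with hG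
  have hex : ∃ n, v < G n := by
    by_contra hcon
    push Not at hcon
    refine absurd h2 (not_lt.2 ?_)
    rw [e, ENNReal.tsum_eq_iSup_sum (f := fun c => hi c - lo c), ENNReal.add_iSup]
    refine iSup_le fun s => ?_
    obtain ⟨n, hn⟩ : ∃ n, ∀ c ∈ s, Encodable.encode c < n :=
      ⟨s.sup Encodable.encode + 1, fun c hc => Nat.lt_succ_of_le (Finset.le_sup hc)⟩
    refine le_trans ?_ (hcon n)
    simp only [hG]
    gcongr
    refine le_trans (le_of_eq ?_) (ENNReal.sum_le_tsum s)
    exact Finset.sum_congr rfl fun c hc => by simp [hn c hc]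
  have hn := Nat.find_spec hex
  have hm := fun m => Nat.find_min (m := m) hex
  rcases hN : Nat.find hex with _ | N
  · rw [hN] at hn
    simp only [hG, not_lt_zero, if_false, tsum_zero, add_zero] at hn
    exact absurd h1 (not_le.2 hn)
  rw [hN] at hn hm
  have hN' : G N ≤ v := not_lt.1 (hm N (Nat.lt_succ_self N))
  by_cases hb : ∃ b : A, Encodable.encode b = N
  · obtain ⟨b, rfl⟩ := hb
    refine ⟨b, hN', lt_of_lt_of_le hn ?_⟩
    simp only [hG]
    rw [add_assoc]
    gcongr
    rw [← tsum_ite_eq b (fun c => hi c - lo c), ← ENNReal.tsum_add]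
    refine ENNReal.tsum_le_tsum fun c => ?_
    by_cases hc : c = b
    · subst hc; simp
    · have : Encodable.encode c ≠ Encodable.encode b := fun h => hc (Encodable.encode_injective h)
      by_cases h : Encodable.encode c < Encodable.encode b
      · simp [h, h.trans (Nat.lt_succ_self _)]
      · have : ¬ Encodable.encode c < Encodable.encode b + 1 := by omega
        simp [this]
  · refine absurd (lt_of_lt_of_le hn ?_) (not_lt.2 hN')
    simp only [hG]
    gcongr with c
    have : Encodable.encode c ≠ N := fun h => hb ⟨c, h⟩
    by_cases h : Encodable.encode c < N
    · simp [h, h.trans (Nat.lt_succ_self _)]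
    · have : ¬ Encodable.encode c < N + 1 := by omega
      simp [this]

theorem length_recent {A : Type*} (x : Past A) (k : ℕ) : (recent x k).length = k := by
  simp [recent]

theorem recent_eq_iff {A : Type*} {x y : Past A} {k : ℕ} :
    recent x k = recent y k ↔ ∀ i < k, x i = y i := by
  simp only [recent, List.ofFn_inj, funext_iff]
  exact ⟨fun h i hi => h ⟨i, hi⟩, fun h i => h i i.2⟩

theorem recent_eq_mono {A : Type*} {x y : Past A} {j k : ℕ} (hjk : j ≤ k)
    (h : recent x k = recent y k) : recent x j = recent y j :=
  recent_eq_iff.2 fun i hi => recent_eq_iff.1 h i (hi.trans_le hjk)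

theorem glue_nil {A : Type*} (z : Past A) : glue [] z = z := by
  funext n; simp [glue]

theorem glue_of_lt {A : Type*} {w : List A} {z : Past A} {n : ℕ} (h : n < w.length) :
    glue w z n = w[n] := by
  simp [glue, h]

theorem glue_cons {A : Type*} (a : A) (w : List A) (z : Past A) :
    glue (a :: w) z = snoc (glue w z) a := by
  funext n
  cases n with
  | zero => simp [glue, snoc]
  | succ n => simp [glue, snoc]

theorem recent_glue {A : Type*} (w : List A) (z : Past A) : recent (glue w z) w.length = w := by
  apply List.ext_getElem (length_recent _ _)
  intro i h1 h2
  simp [recent, glue_of_lt h2]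

theorem glue_recent {A : Type*} (x : Past A) (k : ℕ) :
    glue (recent x k) (fun n => x (n + k)) = x := by
  funext n
  by_cases h : n < k
  · simp [glue, recent, h]
  · simp [glue, length_recent, h]; congr 1; omega

theorem glue_append {A : Type*} (v w : List A) (z : Past A) :
    glue (v ++ w) z = glue v (glue w z) := by
  induction v with
  | nil => simp [glue_nil]
  | cons a v ih => rw [List.cons_append, glue_cons, glue_cons, ih]

theorem infProb_le_append {A : Type*} (P : Ker A) (v w : List A) (a : A) :
    infProb P v a ≤ infProb P (v ++ w) a :=
  le_iInf fun z => by rw [glue_append]; exact iInf_le _ _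

theorem alphaSym_eq {A : Type*} (P : Ker A) : alphaSym P = infProb P [] := by
  funext a; simp [alphaSym, infProb, glue_nil]

theorem infProb_recent_le {A : Type*} (P : Ker A) (x : Past A) (k : ℕ) (a : A) :
    infProb P (recent x k) a ≤ P x a :=
  (iInf_le _ fun n => x (n + k)).trans (by rw [glue_recent])

theorem infProb_recent_mono {A : Type*} (P : Ker A) (x : Past A) (a : A) :
    Monotone fun k => infProb P (recent x k) a := by
  refine monotone_nat_of_le_succ fun k => ?_
  have : recent x (k + 1) = recent x k ++ [x k] := by
    simp only [recent]; rw [List.ofFn_succ_last]; rfl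
  simp only [this]
  exact infProb_le_append _ _ _ _

theorem tsum_infProb_recent_mono {A : Type*} (P : Ker A) (x : Past A) :
    Monotone fun k => ∑' c, infProb P (recent x k) c :=
  fun _ _ h => ENNReal.tsum_le_tsum fun c => infProb_recent_mono P x c h

theorem tsum_iSup_infProb {A : Type*} (P : Ker A) (x : Past A) :
    ∑' c, ⨆ k : ℕ, infProb P (recent x k) c = ⨆ k, ∑' c, infProb P (recent x k) c := by
  let _ : MeasurableSpace A := ⊤
  have := lintegral_iSup (μ := Measure.count) (f := fun k c => infProb P (recent x k) c)
    (fun _ => measurable_from_top) (fun i j h c => infProb_recent_mono P x c h)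
  simpa [lintegral_count] using this

theorem alphaNeg_eq {A : Type*} (P : Ker A) : alphaNeg P = ∑' c, infProb P [] c := by
  simp [alphaNeg, alphaSym_eq]

theorem alphaNeg_le_one {A : Type*} [Nonempty A] (P : Ker A) : alphaNeg P ≤ 1 := by
  rw [← (P (Classical.arbitrary _)).tsum_coe]
  exact ENNReal.tsum_le_tsum fun a => iInf_le _ _

/-- The intervals of levels at most `k` fill the segment below `∑ c, infProb P (recent x k) c`, so a
point of this segment finds its cell from the `k` most recent symbols. -/
theorem mem_cell_of_recent_eq {A : Type*} [Encodable A] (P : Ker A) {x y : Past A} {k : ℕ}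
    (hxy : recent x k = recent y k) {v : ℝ≥0∞} (hv : v < ∑' c, infProb P (recent x k) c) {b : A}
    (h : v ∈ cell P x b) : v ∈ cell P y b := by
  rcases h with (h | h) | h
  · exact Or.inl (Or.inl h)
  · obtain ⟨j, hj⟩ := Set.mem_iUnion.1 h
    have hjk : j + 1 ≤ k := by
      by_contra hcon
      have h1 := (slot_bounds (fun a => infProb_recent_mono P x a (Nat.le_succ j)) hj).1
      have h2 := tsum_infProb_recent_mono P x (show k ≤ j by omega)
      exact absurd hv (not_lt.2 (h2.trans h1))
    refine Or.inl (Or.inr (Set.mem_iUnion.2 ⟨j, ?_⟩))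
    rw [← recent_eq_mono hjk hxy, ← recent_eq_mono ((Nat.le_succ j).trans hjk) hxy]
    exact hj
  · have h1 := (slot_bounds (fun a => iSup_le fun k => infProb_recent_le P x k a) h).1
    rw [tsum_iSup_infProb] at h1
    exact absurd hv (not_lt.2 ((le_iSup (fun k => ∑' c, infProb P (recent x k) c) k).trans h1))

theorem cell_unique {A : Type*} [Encodable A] (P : Ker A) {x : Past A} {v : ℝ≥0∞} {b b' : A}
    (h : v ∈ cell P x b) (h' : v ∈ cell P x b') : b = b' := by
  have hs := fun j => fun a => infProb_recent_mono P x a (Nat.le_succ j)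
  have hS := fun (j k : ℕ) (h : j ≤ k) => tsum_infProb_recent_mono P x h
  have h0 : ∀ {b}, v ∈ slot 0 (alphaSym P) b → v < ∑' c, infProb P (recent x 0) c := by
    intro b h
    have := (slot_bounds (fun a => bot_le) h).2
    rwa [alphaSym_eq] at this
  have hk : ∀ {b k}, v ∈ slot (infProb P (recent x k)) (infProb P (recent x (k + 1))) b →
      ∑' c, infProb P (recent x k) c ≤ v ∧ v < ∑' c, infProb P (recent x (k + 1)) c :=
    fun h => slot_bounds (hs _) h
  have hi : ∀ {b}, v ∈ slot (fun c => ⨆ k : ℕ, infProb P (recent x k) c) (fun c => P x c) b →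
      ∀ k, ∑' c, infProb P (recent x k) c ≤ v := by
    intro b h k
    have h1 := (slot_bounds (fun a => iSup_le fun k => infProb_recent_le P x k a) h).1
    rw [tsum_iSup_infProb] at h1
    exact (le_iSup (fun k => ∑' c, infProb P (recent x k) c) k).trans h1
  rcases h with (h | h) | h <;> rcases h' with (h' | h') | h'
  · exact slot_unique h h'
  · obtain ⟨j, hj⟩ := Set.mem_iUnion.1 h'
    exact absurd (h0 h) (not_lt.2 ((hS 0 j (Nat.zero_le _)).trans (hk hj).1))
  · exact absurd (h0 h) (not_lt.2 (hi h' 0))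
  · obtain ⟨j, hj⟩ := Set.mem_iUnion.1 h
    exact absurd (h0 h') (not_lt.2 ((hS 0 j (Nat.zero_le _)).trans (hk hj).1))
  · obtain ⟨j, hj⟩ := Set.mem_iUnion.1 h
    obtain ⟨j', hj'⟩ := Set.mem_iUnion.1 h'
    rcases lt_trichotomy j j' with hlt | rfl | hlt
    · exact absurd (hk hj).2 (not_lt.2 ((hS (j + 1) j' hlt).trans (hk hj').1))
    · exact slot_unique hj hj'
    · exact absurd (hk hj').2 (not_lt.2 ((hS (j' + 1) j hlt).trans (hk hj).1))
  · obtain ⟨j, hj⟩ := Set.mem_iUnion.1 h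
    exact absurd (hk hj).2 (not_lt.2 (hi h' _))
  · exact absurd (h0 h') (not_lt.2 (hi h 0))
  · obtain ⟨j, hj⟩ := Set.mem_iUnion.1 h'
    exact absurd (hk hj).2 (not_lt.2 (hi h _))
  · exact slot_unique h h'

theorem exists_mem_cell {A : Type*} [Encodable A] (P : Ker A) (x : Past A) {v : ℝ≥0∞}
    (hv : v < 1) : ∃ b, v ∈ cell P x b := by
  by_cases hex : ∃ k, v < ∑' c, infProb P (recent x k) c
  · classical
    have hn := Nat.find_spec hex
    have hm := fun m => Nat.find_min (m := m) hex
    rcases hN : Nat.find hex with _ | N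
    · rw [hN] at hn
      obtain ⟨b, hb⟩ := exists_mem_slot (lo := 0) (hi := alphaSym P) (fun a => bot_le)
        (by simp) (by rw [alphaSym_eq]; exact hn)
      exact ⟨b, Or.inl (Or.inl hb)⟩
    · rw [hN] at hn hm
      obtain ⟨b, hb⟩ := exists_mem_slot (fun a => infProb_recent_mono P x a (Nat.le_succ N))
        (not_lt.1 (hm N (Nat.lt_succ_self N))) hn
      exact ⟨b, Or.inl (Or.inr (Set.mem_iUnion.2 ⟨N, hb⟩))⟩
  · push Not at hex
    obtain ⟨b, hb⟩ := exists_mem_slot (lo := fun c => ⨆ k : ℕ, infProb P (recent x k) c)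
      (hi := fun c => P x c) (v := v) (fun a => iSup_le fun k => infProb_recent_le P x k a)
      (by rw [tsum_iSup_infProb]; exact iSup_le hex) (by rw [(P x).tsum_coe]; exact hv)
    exact ⟨b, Or.inr hb⟩

theorem update_eq_of_mem {A : Type*} [Encodable A] [Nonempty A] (P : Ker A) {x : Past A} {u : ℝ}
    {b : A} (h : ENNReal.ofReal u ∈ cell P x b) : update P x u = b := by
  have hex : ∃ b, ENNReal.ofReal u ∈ cell P x b := ⟨b, h⟩
  rw [update, dif_pos hex]
  exact cell_unique P hex.choose_spec h

theorem update_eq_of_recent_eq {A : Type*} [Encodable A] [Nonempty A] (P : Ker A) {x y : Past A}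
    {u : ℝ} {k : ℕ} (hxy : recent x k = recent y k)
    (hv : ENNReal.ofReal u < ∑' c, infProb P (recent x k) c) : update P x u = update P y u := by
  have h1 : ENNReal.ofReal u < 1 := by
    rw [← (P x).tsum_coe]
    exact hv.trans_le (ENNReal.tsum_le_tsum fun c => infProb_recent_le P x k c)
  obtain ⟨b, hb⟩ := exists_mem_cell P x h1
  rw [update_eq_of_mem P hb, update_eq_of_mem P (mem_cell_of_recent_eq P hxy hv hb)]

theorem spontaneous_eq_some {A : Type*} [Encodable A] {P : Ker A} {u : ℝ} {a : A} :
    spontaneous P u = some a ↔ ENNReal.ofReal u ∈ slot 0 (alphaSym P) a := by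
  constructor
  · intro h
    rw [spontaneous] at h
    split_ifs at h with hex
    exact Option.some.inj h ▸ hex.choose_spec
  · intro h
    have hex : ∃ b, ENNReal.ofReal u ∈ slot 0 (alphaSym P) b := ⟨a, h⟩
    rw [spontaneous, dif_pos hex, slot_unique hex.choose_spec h]

theorem isSome_spontaneous {A : Type*} [Encodable A] {P : Ker A} {u : ℝ} :
    (spontaneous P u).isSome ↔ ENNReal.ofReal u < alphaNeg P := by
  rw [Option.isSome_iff_exists]
  simp only [spontaneous_eq_some]
  constructor
  · rintro ⟨a, ha⟩
    exact (slot_bounds (fun a => bot_le) ha).2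
  · exact fun h => exists_mem_slot (fun a => bot_le) (by simp) h

theorem update_eq_of_spontaneous {A : Type*} [Encodable A] [Nonempty A] {P : Ker A} {u : ℝ} {a : A}
    (h : spontaneous P u = some a) (x : Past A) : update P x u = a :=
  update_eq_of_mem P (Or.inl (Or.inl (spontaneous_eq_some.1 h)))

/-! ### Measurability of the update rule -/

/-- A union of arbitrarily many half-open intervals is the union of their interiors, which is open,
and of the left ends that it misses. The intervals that start at these ends are disjoint, so there
are countably many of them. -/
theorem measurableSet_iUnion_Ico {α ι : Type*} [TopologicalSpace α] [LinearOrder α]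
    [OrderTopology α] [SecondCountableTopology α] [MeasurableSpace α] [BorelSpace α]
    (l r : ι → α) : MeasurableSet (⋃ i, Set.Ico (l i) (r i)) := by
  classical
  set O : Set α := ⋃ i, Set.Ioo (l i) (r i) with hO
  have hOm : MeasurableSet O := (isOpen_iUnion fun i => isOpen_Ioo).measurableSet
  set Z : Set α := (⋃ i, Set.Ico (l i) (r i)) \ O with hZ
  have hz : ∀ z ∈ Z, ∃ y, z < y ∧ Set.Ioo z y ⊆ O := by
    rintro z ⟨hz, hzO⟩
    obtain ⟨i, hi⟩ := Set.mem_iUnion.1 hz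
    have hl : l i = z := by
      by_contra hne
      exact hzO (Set.mem_iUnion.2 ⟨i, lt_of_le_of_ne hi.1 hne, hi.2⟩)
    refine ⟨r i, hi.2, ?_⟩
    rw [← hl]
    exact Set.subset_iUnion (fun i => Set.Ioo (l i) (r i)) i
  choose! y hy hyO using hz
  have hcount : Z.Countable := by
    refine Set.PairwiseDisjoint.countable_of_Ioo (y := y) ?_ hy
    have key : ∀ z ∈ Z, ∀ z' ∈ Z, z < z' → Disjoint (Set.Ioo z (y z)) (Set.Ioo z' (y z')) := by
      intro z hz z' hz' hlt
      rw [Set.disjoint_left]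
      intro a ha ha'
      exact hz'.2 (hyO z hz ⟨hlt, ha'.1.trans ha.2⟩)
    intro z hz z' hz' hne
    rcases lt_or_gt_of_ne hne with h | h
    · exact key z hz z' hz' h
    · exact (key z' hz' z hz h).symm
  have : (⋃ i, Set.Ico (l i) (r i)) = O ∪ Z := by
    rw [hZ, Set.union_sdiff_cancel]
    exact Set.iUnion_mono fun i => Set.Ioo_subset_Ico_self
  rw [this]
  exact hOm.union hcount.measurableSet

theorem measurableSet_iUnion_slot {A ι : Type*} [Encodable A] (lo hi : ι → A → ℝ≥0∞) (b : A) :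
    MeasurableSet (⋃ i, slot (lo i) (hi i) b) :=
  measurableSet_iUnion_Ico _ _

theorem measurableSet_iUnion_cell {A ι : Type*} [Encodable A] (P : Ker A) (x : ι → Past A) (b : A) :
    MeasurableSet (⋃ i, cell P (x i) b) := by
  have : (⋃ i, cell P (x i) b) = (⋃ _i : ι, slot 0 (alphaSym P) b) ∪
      (⋃ k : ℕ, ⋃ i, slot (infProb P (recent (x i) k)) (infProb P (recent (x i) (k + 1))) b) ∪
      ⋃ i, slot (fun c => ⨆ k : ℕ, infProb P (recent (x i) k) c) (fun c => P (x i) c) b := by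
    rw [Set.iUnion_comm]
    simp only [cell, Set.iUnion_union_distrib]
  rw [this]
  exact ((measurableSet_iUnion_slot _ _ b).union
    (MeasurableSet.iUnion fun k => measurableSet_iUnion_slot _ _ b)).union
    (measurableSet_iUnion_slot _ _ b)

/-- The pasts range over an uncountable set. The complement is a countable union, over the other
symbols, of unions of cells. -/
theorem measurableSet_forall_update {A ι : Type*} [Encodable A] [Nonempty A] (P : Ker A)
    (x : ι → Past A) (a : A) : MeasurableSet {u : ℝ | ∀ i, update P (x i) u = a} := by
  have h1 : MeasurableSet {u : ℝ | ENNReal.ofReal u < 1} :=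
    measurableSet_lt ENNReal.measurable_ofReal measurable_const
  have h2 : MeasurableSet {u : ℝ | ∀ _i : ι, Classical.arbitrary A = a} := MeasurableSet.const _
  have h3 : MeasurableSet (⋃ c : {c : A // c ≠ a}, ENNReal.ofReal ⁻¹' ⋃ i, cell P (x i) c) :=
    MeasurableSet.iUnion fun c =>
      ENNReal.measurable_ofReal (measurableSet_iUnion_cell P x c)
  have : {u : ℝ | ∀ i, update P (x i) u = a} =
      ({u : ℝ | ENNReal.ofReal u < 1} \
        ⋃ c : {c : A // c ≠ a}, ENNReal.ofReal ⁻¹' ⋃ i, cell P (x i) c) ∪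
      ({u : ℝ | ENNReal.ofReal u < 1}ᶜ ∩ {u : ℝ | ∀ _i : ι, Classical.arbitrary A = a}) := by
    ext u
    by_cases hu : ENNReal.ofReal u < 1
    · simp only [Set.mem_ofPred_eq, Set.mem_union, Set.mem_sdiff, hu, true_and, Set.mem_inter_iff,
        Set.mem_compl_iff, not_true, false_and, or_false, Set.mem_iUnion, Set.mem_preimage]
      constructor
      · rintro h ⟨c, i, hc⟩
        exact c.2 ((update_eq_of_mem P hc).symm.trans (h i))
      · intro h i
        obtain ⟨b, hb⟩ := exists_mem_cell P (x i) hu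
        rw [update_eq_of_mem P hb]
        by_contra hne
        exact h ⟨⟨b, hne⟩, i, hb⟩
    · have hno : ∀ i, update P (x i) u = Classical.arbitrary A := by
        intro i
        rw [update, dif_neg]
        rintro ⟨b, hb⟩
        apply hu
        rcases hb with (hb | hb) | hb
        · refine (slot_bounds (fun a => bot_le) hb).2.trans_le ?_
          rw [← (P (x i)).tsum_coe]
          exact ENNReal.tsum_le_tsum fun a => iInf_le _ _
        · obtain ⟨k, hk⟩ := Set.mem_iUnion.1 hb
          refine (slot_bounds (fun a => infProb_recent_mono P _ a (Nat.le_succ k)) hk).2.trans_le ?_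
          rw [← (P (x i)).tsum_coe]
          exact ENNReal.tsum_le_tsum fun a => infProb_recent_le P _ _ a
        · refine (slot_bounds (fun a => iSup_le fun k => infProb_recent_le P _ k a)
            hb).2.trans_le ?_
          rw [(P (x i)).tsum_coe]
      have hu' : ¬ u < 1 := by simpa using hu
      simp [hno, hu']
  rw [this]
  exact (h1.diff h3).union (h1.compl.inter h2)

theorem measurableSet_spontaneous {A : Type*} [Encodable A] (P : Ker A) (y : Option A) :
    MeasurableSet {u : ℝ | spontaneous P u = y} := by
  cases y with
  | none =>
    have : {u : ℝ | spontaneous P u = none} = {u : ℝ | ENNReal.ofReal u < alphaNeg P}ᶜ := by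
      ext u
      rw [Set.mem_compl_iff, Set.mem_ofPred_eq, Set.mem_ofPred_eq, ← isSome_spontaneous]
      simp
    rw [this]
    exact (measurableSet_lt ENNReal.measurable_ofReal measurable_const).compl
  | some a =>
    have : {u : ℝ | spontaneous P u = some a} = ENNReal.ofReal ⁻¹' slot 0 (alphaSym P) a := by
      ext u; exact spontaneous_eq_some
    rw [this]
    exact ENNReal.measurable_ofReal measurableSet_Ico

/-! ### Coalescence of finite windows -/

/-- The `n` symbols produced by the updates that start at time `t` from the past `x`, the most
recent one first. -/
def word {A : Type*} (F : Past A → ℝ → A) (u : ℤ → ℝ) (t : ℤ) (x : Past A) : ℕ → List A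
  | 0 => []
  | n + 1 => F (glue (word F u t x n) x) (u (t + n)) :: word F u t x n

/-- Started at time `t`, the first `w.length` updates produce the string `w` (most recent symbol
first) from every past. -/
def Yields {A : Type*} (F : Past A → ℝ → A) (u : ℤ → ℝ) (t : ℤ) (w : List A) : Prop :=
  ∀ x, word F u t x w.length = w

/-- The `n` symbols produced by the updates that start at time `t` do not depend on the past. -/
def Coalesces {A : Type*} (F : Past A → ℝ → A) (u : ℤ → ℝ) (t : ℤ) (n : ℕ) : Prop :=
  ∃ w : List A, w.length = n ∧ Yields F u t w

section Coalescence

variable {A : Type*} {F : Past A → ℝ → A} {u : ℤ → ℝ}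

@[simp] theorem length_word (t : ℤ) (x : Past A) (n : ℕ) : (word F u t x n).length = n := by
  induction n with
  | zero => rfl
  | succ n ih => simp [word, ih]

theorem evolve_eq_glue (t : ℤ) (x : Past A) (n : ℕ) :
    evolve F u t x n = glue (word F u t x n) x := by
  induction n with
  | zero => simp [evolve, word, glue_nil]
  | succ n ih => rw [evolve, word, glue_cons, ih]

theorem iter_add (t : ℤ) (x : Past A) (n : ℕ) :
    iter F u t (t + n) x = F (glue (word F u t x n) x) (u (t + n)) := by
  simp [iter, evolve_eq_glue]

theorem evolve_add (t : ℤ) (x : Past A) (m n : ℕ) :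
    evolve F u t x (m + n) = evolve F u (t + m) (evolve F u t x m) n := by
  induction n with
  | zero => rfl
  | succ n ih =>
    rw [← add_assoc, evolve, evolve, ih]
    congr 3
    push_cast; ring

theorem word_add (t : ℤ) (x : Past A) (m n : ℕ) :
    word F u t x (m + n) =
      word F u (t + m) (glue (word F u t x m) x) n ++ word F u t x m := by
  induction n with
  | zero => rfl
  | succ n ih =>
    rw [← add_assoc, word, word, ih, List.cons_append, glue_append]
    congr 3
    push_cast; ring

theorem yields_nil (t : ℤ) : Yields F u t [] := fun _ => rfl

theorem yields_cons {t : ℤ} {a : A} {w : List A} :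
    Yields F u t (a :: w) ↔ Yields F u t w ∧ ∀ x, F (glue w x) (u (t + w.length)) = a := by
  simp only [Yields, List.length_cons, word, List.cons.injEq]
  constructor
  · intro h
    refine ⟨fun x => (h x).2, fun x => ?_⟩
    have := (h x).1
    rwa [(h x).2] at this
  · rintro ⟨h1, h2⟩ x
    refine ⟨?_, h1 x⟩
    rw [h1 x, h2 x]

theorem Yields.append {t : ℤ} {v w : List A} (hv : Yields F u t v)
    (hw : Yields F u (t + v.length) w) : Yields F u t (w ++ v) := by
  intro x
  rw [List.length_append, add_comm, word_add, hv x, hw]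

theorem Yields.of_append {t : ℤ} {v w : List A} (h : Yields F u t (w ++ v)) :
    Yields F u t v := by
  intro x
  have := h x
  rw [List.length_append, add_comm, word_add] at this
  exact (List.append_inj' this (by simp)).2

theorem Yields.take {t : ℤ} {l : List A} (h : Yields F u t l.reverse) (n : ℕ) :
    Yields F u t (l.take n).reverse := by
  apply Yields.of_append (w := (l.drop n).reverse)
  rwa [← List.reverse_append, List.take_append_drop]

theorem Yields.eq [Nonempty A] {t : ℤ} {v w : List A} (hv : Yields F u t v) (hw : Yields F u t w)
    (h : v.length = w.length) : v = w := by
  rw [← hv (Classical.arbitrary _), ← hw (Classical.arbitrary _), h]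

theorem Coalesces.mono {t : ℤ} {m n : ℕ} (h : Coalesces F u t n) (hmn : m ≤ n) :
    Coalesces F u t m := by
  obtain ⟨w, rfl, hw⟩ := h
  refine ⟨w.drop (w.length - m), by simp; omega, ?_⟩
  apply Yields.of_append (w := w.take (w.length - m))
  rwa [List.take_append_drop]

theorem isRegenTime_iff_forall_iter {t : ℤ} :
    IsRegenTime F u t ↔ ∀ (n : ℕ) (x y : Past A), iter F u t (t + n) x = iter F u t (t + n) y := by
  constructor
  · intro h n x y
    exact h.1.2 (t + n) (by omega) le_top x y
  · intro h
    refine ⟨⟨le_rfl, fun i hi _ x y => ?_⟩, fun j hj => hj.1⟩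
    obtain ⟨n, rfl⟩ := Int.le.dest hi
    exact h n x y

theorem isRegenTime_iff [Nonempty A] {t : ℤ} :
    IsRegenTime F u t ↔ ∀ n : ℕ, Coalesces F u t n := by
  rw [isRegenTime_iff_forall_iter]
  constructor
  · intro h n
    induction n with
    | zero => exact ⟨[], rfl, yields_nil t⟩
    | succ n ih =>
      obtain ⟨w, rfl, hw⟩ := ih
      refine ⟨iter F u t (t + w.length) (Classical.arbitrary _) :: w, rfl,
        yields_cons.2 ⟨hw, fun x => ?_⟩⟩
      rw [h w.length _ x, iter_add, hw x]
  · intro h n x y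
    obtain ⟨w, hl, hw⟩ := h (n + 1)
    cases w with
    | nil => simp at hl
    | cons a w =>
      obtain ⟨h1, h2⟩ := yields_cons.1 hw
      obtain rfl : w.length = n := by simpa using hl
      rw [iter_add, iter_add, h1 x, h1 y, h2 x, h2 y]

theorem isRegenTime_iff_coalesces [Nonempty A] {t : ℤ} {m : ℕ} (h : IsRegenTime F u (t + m)) :
    IsRegenTime F u t ↔ Coalesces F u t m := by
  rw [isRegenTime_iff] at h ⊢
  refine ⟨fun ht => ht m, fun hm n => ?_⟩
  obtain ⟨v, rfl, hv⟩ := hm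
  obtain ⟨w, rfl, hw⟩ := h n
  exact Coalesces.mono ⟨w ++ v, rfl, hv.append hw⟩ (by simp)

/-- The reconstruction at a time of a coalesced window starts from the coalescence time, which lies
in that window, and so agrees with the symbol produced from the start of the window. -/
theorem reconstruct_eq [Nonempty A] {t : ℤ} {a : A} {w : List A} (h : Yields F u t (a :: w)) :
    reconstruct F u (t + w.length) = a := by
  obtain ⟨h1, h2⟩ := yields_cons.1 h
  have ha : ∀ x, iter F u t (t + w.length) x = a := fun x => by rw [iter_add, h1 x, h2 x]
  set i : ℤ := t + w.length with hi
  set C := coalTimes F u i (i : WithTop ℤ) with hC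
  have htC : t ∈ C := by
    refine ⟨by omega, fun j hj hj' x y => ?_⟩
    obtain rfl : j = i := le_antisymm (WithTop.coe_le_coe.1 hj') hj
    rw [ha, ha]
  have hbdd : BddAbove C := ⟨i, fun j hj => hj.1⟩
  have hmem : sSup C ∈ C := Int.csSup_mem ⟨t, htC⟩ hbdd
  have hle : t ≤ sSup C := le_csSup hbdd htC
  rw [reconstruct, ← hC]
  obtain ⟨m, hm⟩ := Int.le.dest hle
  have hsi : sSup C ≤ i := hmem.1
  rw [← ha (Classical.arbitrary _),
    hmem.2 i le_rfl le_rfl _ (evolve F u t (Classical.arbitrary _) m), iter, iter]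
  have : (i - t).toNat = m + (i - sSup C).toNat := by omega
  rw [this, evolve_add, hm]

theorem stringBetween_reconstruct [Nonempty A] {t : ℤ} {l : List A}
    (h : Yields F u t l.reverse) : stringBetween (reconstruct F u) t (t + l.length) = l := by
  apply List.ext_getElem
  · simp [stringBetween]
  intro n h1 h2
  simp only [stringBetween, List.getElem_ofFn]
  have h3 := h.take (n + 1)
  rw [List.take_succ_eq_append_getElem h2, List.reverse_append] at h3
  have h4 := reconstruct_eq (F := F) (u := u) (t := t) (a := l[n]) (w := (l.take n).reverse)
    (by simpa using h3)
  simpa [h2.le] using h4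

theorem stringBetween_eq_iff [Nonempty A] {t s : ℤ} (hts : t ≤ s) (ht : IsRegenTime F u t)
    {l : List A} :
    stringBetween (reconstruct F u) t s = l ↔ s = t + l.length ∧ Yields F u t l.reverse := by
  constructor
  · intro h
    obtain ⟨n, rfl⟩ := Int.le.dest hts
    obtain ⟨w, rfl, hw⟩ := isRegenTime_iff.1 ht n
    have h1 := stringBetween_reconstruct (F := F) (u := u) (t := t) (l := w.reverse) (by simpa)
    rw [List.length_reverse, h] at h1
    subst h1
    simpa using hw
  · rintro ⟨rfl, h⟩
    exact stringBetween_reconstruct h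

/-! ### Cycles between consecutive regeneration times -/

/-- The part of the event "`t` and `t + w.length` are consecutive regeneration times, and the string
between them is `w`" that concerns the window from `t` to `t + w.length - 1`; the other part is that
`t + w.length` is a regeneration time. The string is written from the oldest symbol to the most
recent one. -/
def IsCycle (F : Past A → ℝ → A) (u : ℤ → ℝ) (t : ℤ) (w : List A) : Prop :=
  w ≠ [] ∧ Yields F u t w.reverse ∧
    ∀ k : ℕ, 0 < k → k < w.length → ¬ Coalesces F u (t + k) (w.length - k)

/-- `t` is a regeneration time, and the strings between the successive regeneration times from `t`
on start with the given list of strings. -/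
def StartsWith (F : Past A → ℝ → A) (u : ℤ → ℝ) : List (List A) → ℤ → Prop
  | [], t => IsRegenTime F u t
  | w :: ws, t => IsCycle F u t w ∧ StartsWith F u ws (t + w.length)

theorem isCycle_iff [Nonempty A] {t : ℤ} {w : List A} (h : IsRegenTime F u (t + w.length)) :
    IsCycle F u t w ↔ w ≠ [] ∧ Yields F u t w.reverse ∧
      ∀ k : ℕ, 0 < k → k < w.length → ¬ IsRegenTime F u (t + k) := by
  refine and_congr_right fun _ => and_congr_right fun _ => forall_congr' fun k =>
    forall_congr' fun _ => forall_congr' fun hk => not_congr ?_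
  refine (isRegenTime_iff_coalesces ?_).symm
  convert h using 1
  omega

theorem StartsWith.isRegenTime [Nonempty A] {ws : List (List A)} {t : ℤ}
    (h : StartsWith F u ws t) : IsRegenTime F u t := by
  induction ws generalizing t with
  | nil => exact h
  | cons w ws ih =>
    exact (isRegenTime_iff_coalesces (ih h.2)).2 ⟨w.reverse, by simp, h.1.2.1⟩

theorem startsWith_iff [Nonempty A] {T : ℤ → ℤ} (hT : ∀ t, IsRegenTime F u t ↔ ∃ l, T l = t)
    (hmono : StrictMono T) {ws : List (List A)} {l : ℤ} :
    StartsWith F u ws (T l) ↔ ∀ (j : ℕ) (h : j < ws.length),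
      stringBetween (reconstruct F u) (T (l + j)) (T (l + j + 1)) = ws[j] := by
  induction ws generalizing l with
  | nil => simpa [StartsWith] using (hT _).2 ⟨l, rfl⟩
  | cons w ws ih =>
    have hreg : ∀ l, IsRegenTime F u (T l) := fun l => (hT _).2 ⟨l, rfl⟩
    have hstep : IsCycle F u (T l) w ∧ IsRegenTime F u (T l + w.length) ↔
        stringBetween (reconstruct F u) (T l) (T (l + 1)) = w := by
      rw [stringBetween_eq_iff (hmono (lt_add_one l)).le (hreg l)]
      constructor
      · rintro ⟨h1, h2⟩
        obtain ⟨hne, hy, hno⟩ := (isCycle_iff h2).1 h1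
        obtain ⟨m, hm⟩ := (hT _).1 h2
        have hpos : 0 < w.length := List.length_pos_iff.2 hne
        have hlm : l < m := hmono.lt_iff_lt.1 (by omega)
        refine ⟨?_, hy⟩
        rcases eq_or_lt_of_le (Int.add_one_le_of_lt hlm) with h | h
        · rw [h, hm]
        · have h3 := hmono h
          have h4 := hmono (lt_add_one l)
          refine absurd (hreg (l + 1)) ?_
          have := hno (T (l + 1) - T l).toNat (by omega) (by omega)
          convert this using 2
          omega
      · rintro ⟨h1, h2⟩
        have h3 := hreg (l + 1)
        rw [h1] at h3
        have h4 := hmono (lt_add_one l)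
        refine ⟨(isCycle_iff h3).2 ⟨?_, h2, ?_⟩, h3⟩
        · rintro rfl
          simp at h1; omega
        · intro k hk0 hk hR
          obtain ⟨m, hm⟩ := (hT _).1 hR
          have := hmono.lt_iff_lt.1 (show T l < T m by omega)
          have := hmono.lt_iff_lt.1 (show T m < T (l + 1) by omega)
          omega
    constructor
    · rintro ⟨h1, h2⟩ j hj
      have h3 := hstep.1 ⟨h1, h2.isRegenTime⟩
      cases j with
      | zero => simpa using h3
      | succ j =>
        have h4 := ((stringBetween_eq_iff (hmono (lt_add_one l)).le (hreg l)).1 h3).1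
        rw [← h4] at h2
        have := ih.1 h2 j (by simpa using hj)
        simp only [List.getElem_cons_succ, Nat.cast_add, Nat.cast_one]
        rw [← this, show l + ((j : ℤ) + 1) = l + 1 + j by ring]
    · intro h
      have h0 : stringBetween (reconstruct F u) (T l) (T (l + 1)) = w := by
        have := h 0 (Nat.succ_pos _)
        rwa [Nat.cast_zero, add_zero] at this
      have h4 := ((stringBetween_eq_iff (hmono (lt_add_one l)).le (hreg l)).1 h0).1
      refine ⟨(hstep.2 h0).1, ?_⟩
      rw [← h4, ih]
      intro j hj
      have := h (j + 1) (by simpa using hj)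
      simp only [List.getElem_cons_succ, Nat.cast_add, Nat.cast_one] at this
      rw [← this, show l + ((j : ℤ) + 1) = l + 1 + j by ring]

end Coalescence

/-! ### Context lengths known from a window -/

theorem IsSkeleton.isContextTree {A : Type*} {τ : Set (Str A)} (h : IsSkeleton τ) :
    IsContextTree τ := by
  rcases h with rfl | h
  · refine ⟨fun x => ⟨Sum.inl [], ⟨rfl, by simp [Str.SuffixOfPast, recent]⟩, fun v hv => hv.1⟩, ?_⟩
    rintro v rfl v' rfl -
    rfl
  · exact h.1

theorem IsContextTree.contextLen_eq {A : Type*} {τ : Set (Str A)} (hτ : IsContextTree τ)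
    {x : Past A} {v : Str A} (hv : v ∈ τ) (hvx : v.SuffixOfPast x) : contextLen τ x = v.len := by
  apply le_antisymm
  · exact iInf₂_le v ⟨hv, hvx⟩
  · refine le_iInf₂ fun v' hv' => ?_
    rw [(hτ.partition x).unique ⟨hv, hvx⟩ hv']

theorem IsContextTree.exists_context {A : Type*} {τ : Set (Str A)} (hτ : IsContextTree τ)
    {x : Past A} {m : ℕ} (h : contextLen τ x ≤ m) :
    ∃ v : List A, Sum.inl v ∈ τ ∧ v.length ≤ m ∧ recent x v.length = v := by
  obtain ⟨v, ⟨hv, hvx⟩, -⟩ := hτ.partition x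
  rw [hτ.contextLen_eq hv hvx] at h
  rcases v with v | y
  · exact ⟨v, hv, by simpa [Str.len] using h, hvx⟩
  · simp [Str.len] at h

theorem IsContextTree.contextLen_le_of_recent_eq {A : Type*} {τ : Set (Str A)}
    (hτ : IsContextTree τ) {x y : Past A} {m n : ℕ} (h : contextLen τ x ≤ m) (hmn : m ≤ n)
    (hxy : recent x n = recent y n) : contextLen τ y ≤ m := by
  obtain ⟨v, hv, hvm, hvx⟩ := hτ.exists_context h
  rw [recent_eq_mono (hvm.trans hmn) hxy] at hvx
  rw [hτ.contextLen_eq hv hvx]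
  simpa [Str.len] using hvm

section Safe

variable {A : Type*} [Encodable A]

/-- The past `x`, placed before time `t + n`, agrees with `Y` at those times of the window
`t, …, t + n - 1` at which `Y` is a symbol. -/
def Compatible (P : Ker A) (u : ℤ → ℝ) (t : ℤ) (n : ℕ) (x : Past A) : Prop :=
  ∀ i < n, ∀ a, spontaneous P (u (t + n - 1 - i)) = some a → x i = a

/-- The values of `Y` at the times `t, …, t + n - 1` show that the context at time `t + n` has
length at most `m`. For `m ≤ n` this means that `c_τ^{t+n-1} ≤ m`, but it is visibly local. -/
def KnownContext (P : Ker A) (τ : Set (Str A)) (u : ℤ → ℝ) (t : ℤ) (n m : ℕ) : Prop :=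
  ∀ x, Compatible P u t n x → contextLen τ x ≤ m

/-- A condition on the uniform variables at the times `t, …, t + n` under which the symbol at time
`t + n` is determined by those at the times `t, …, t + n - 1`: either it is spontaneous, or the
context, of length at most `m`, and `k` further symbols lie in the window and suffice. -/
def Safe (P : Ker A) (τ : Set (Str A)) (u : ℤ → ℝ) (t : ℤ) (n : ℕ) : Prop :=
  (spontaneous P (u (t + n))).isSome ∨ ∃ k m : ℕ, m + k ≤ n ∧ KnownContext P τ u t n m ∧
    ENNReal.ofReal (u (t + n)) < alphaLen P τ k m

variable {P : Ker A} {τ : Set (Str A)} {u : ℤ → ℝ}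

theorem update_eq_of_lt_alphaLen [Nonempty A] (hτ : IsContextTree τ) {x y : Past A} {v : ℝ}
    {k m n : ℕ} (hx : contextLen τ x ≤ m) (hmn : m + k ≤ n) (hxy : recent x n = recent y n)
    (hv : ENNReal.ofReal v < alphaLen P τ k m) : update P x v = update P y v := by
  obtain ⟨c, hc, hcm, hcx⟩ := hτ.exists_context hx
  refine update_eq_of_recent_eq P (k := c.length + k) (recent_eq_mono (by omega) hxy)
    (hv.trans_le ?_)
  have h1 : alphaLen P τ k m ≤ alphaStr P c k :=
    iInf₂_le c ⟨hc, by exact_mod_cast hcm⟩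
  refine h1.trans ?_
  have h2 : recent x (c.length + k) = c ++ (recent x (c.length + k)).drop c.length := by
    conv_lhs => rw [← List.take_append_drop c.length (recent x (c.length + k))]
    congr 1
    rw [← hcx]
    apply List.ext_getElem
    · simp [length_recent]
    · intro i h1 h2; simp [recent]; rfl
  rw [h2]
  exact iInf₂_le _ (by simp [length_recent])

theorem coalesces_of_safe [Nonempty A] (hτ : IsContextTree τ) {t : ℤ} {n : ℕ}
    (h : ∀ i < n, Safe P τ u t i) : Coalesces (update P) u t n := by
  suffices ∃ w : List A, w.length = n ∧ Yields (update P) u t w ∧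
      ∀ x, Compatible P u t n (glue w x) by
    obtain ⟨w, h1, h2, -⟩ := this
    exact ⟨w, h1, h2⟩
  induction n with
  | zero => exact ⟨[], rfl, yields_nil t, fun x i hi => absurd hi (Nat.not_lt_zero i)⟩
  | succ n ih =>
    obtain ⟨w, rfl, hw, hcomp⟩ := ih fun i hi => h i (hi.trans (Nat.lt_succ_self n))
    have hstep : ∃ a, ∀ x, update P (glue w x) (u (t + w.length)) = a := by
      rcases h w.length (Nat.lt_succ_self _) with h | ⟨k, m, hmk, hK, hlt⟩
      · obtain ⟨a, ha⟩ := Option.isSome_iff_exists.1 h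
        exact ⟨a, fun x => update_eq_of_spontaneous ha _⟩
      · refine ⟨update P (glue w (Classical.arbitrary _)) (u (t + w.length)), fun x => ?_⟩
        exact update_eq_of_lt_alphaLen hτ (hK _ (hcomp x)) hmk
          (by rw [recent_glue, recent_glue]) hlt
    obtain ⟨a, ha⟩ := hstep
    refine ⟨a :: w, rfl, yields_cons.2 ⟨hw, ha⟩, fun x i hi b hb => ?_⟩
    rw [glue_cons]
    cases i with
    | zero =>
      have : t + ((w.length + 1 : ℕ) : ℤ) - 1 - ((0 : ℕ) : ℤ) = t + w.length := by push_cast; ring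
      rw [this] at hb
      rw [← ha x]
      exact update_eq_of_spontaneous hb _
    | succ i =>
      have : t + ((w.length + 1 : ℕ) : ℤ) - 1 - ((i + 1 : ℕ) : ℤ) = t + w.length - 1 - i := by
        push_cast; ring
      rw [this] at hb
      exact hcomp x i (by omega) b hb

theorem isRegenTime_of_safe [Nonempty A] (hτ : IsContextTree τ) {t : ℤ}
    (h : ∀ n, Safe P τ u t n) : IsRegenTime (update P) u t :=
  isRegenTime_iff.2 fun _ => coalesces_of_safe hτ fun i _ => h i

theorem knownContext_of_maxContext_le (hτ : IsContextTree τ) {t : ℤ} {m n : ℕ} (hmn : m ≤ n)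
    (h : maxContext P τ u (t + n - 1) ≤ m) : KnownContext P τ u t n m := by
  intro x hx
  refine hτ.contextLen_le_of_recent_eq
    ((le_iSup (fun a => contextLen τ (filledPast P u (t + n - 1) a))
      fun i => x (t + n - 1 - i).toNat).trans h) hmn (recent_eq_iff.2 fun i hi => ?_)
  have : (t + n - 1 - (t + n - 1 - (i : ℤ))).toNat = i := by omega
  simp only [filledPast, this]
  cases hs : spontaneous P (u (t + n - 1 - i)) with
  | none => rfl
  | some a => exact (hx i hi a hs).symm

theorem maxContext_le_of_knownContext {t : ℤ} {m n : ℕ} (h : KnownContext P τ u t n m) :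
    maxContext P τ u (t + n - 1) ≤ m :=
  iSup_le fun a => h _ fun i _ b hb => by simp [filledPast, hb]

theorem safe_neg (hτ : IsContextTree τ) {k m n : ℕ} (hmn : m + k ≤ n)
    (h : (spontaneous P (u 0)).isSome ∨ KnownContext P τ u (-m) m m)
    (hlt : ENNReal.ofReal (u 0) < alphaLen P τ k (maxContext P τ u (-1))) :
    Safe P τ u (-n) n := by
  rcases h with h | h
  · left; simpa using h
  right
  have h1 := maxContext_le_of_knownContext h
  rw [neg_add_cancel, zero_sub] at h1
  obtain ⟨c, hc⟩ := ENat.ne_top_iff_exists.1 (ne_top_of_le_ne_top (ENat.natCast_ne_top m) h1)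
  rw [← hc] at h1 hlt
  have hcm : c ≤ m := by exact_mod_cast h1
  refine ⟨k, c, by omega, knownContext_of_maxContext_le hτ (by omega) ?_, ?_⟩
  · rw [neg_add_cancel, zero_sub, ← hc]
  · simpa using hlt

theorem lt_absGood (hτ : IsContextTree τ) {m : ℕ}
    (h : ¬ ((spontaneous P (u 0)).isSome ∨ KnownContext P τ u (-m) m m)) :
    ((m + 1 : ℕ) : ℕ∞) ≤ absGood P τ u := by
  refine le_iInf₂ fun i hi => ?_
  obtain ⟨hi0, hi⟩ := hi
  by_contra hcon
  rw [not_le, Nat.cast_lt] at hcon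
  rcases hi 0 hi0 le_rfl with h1 | h1
  · exact h (Or.inl h1)
  · refine h (Or.inr (knownContext_of_maxContext_le hτ le_rfl ?_))
    rw [neg_add_cancel]
    refine h1.trans ?_
    norm_cast
    omega

/-- `u'` arises from `u` by turning some of the times at which `Y` is `⋆` into times at which it is
a symbol. -/
def Refines (P : Ker A) (u' u : ℤ → ℝ) : Prop :=
  ∀ j, u' j = u j ∨ spontaneous P (u j) = none ∧ (spontaneous P (u' j)).isSome

theorem Safe.of_refines {u' : ℤ → ℝ} {t : ℤ} {n : ℕ} (h : Safe P τ u t n) (hu : Refines P u' u) :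
    Safe P τ u' t n := by
  rcases hu (t + n) with h1 | h1
  · unfold Safe
    rw [h1]
    refine h.imp_right ?_
    rintro ⟨k, m, hmk, hK, hlt⟩
    refine ⟨k, m, hmk, fun x hx => hK x fun i hi a ha => ?_, hlt⟩
    rcases hu (t + n - 1 - i) with h2 | h2
    · exact hx i hi a (by rw [h2]; exact ha)
    · rw [h2.1] at ha; cases ha
  · exact Or.inl h1.2

end Safe

/-! ### The law of the uniform sequence -/

/-- The uniform distribution on `[0,1[`. -/
noncomputable def unif : Measure ℝ := volume.restrict (Set.Ico 0 1)

instance : IsProbabilityMeasure unif := ⟨by simp [unif]⟩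

/-- The law of a doubly infinite sequence of independent uniform variables. -/
noncomputable def seqLaw : Measure (ℤ → ℝ) := Measure.infinitePi fun _ => unif

instance : IsProbabilityMeasure seqLaw := by unfold seqLaw; infer_instance

open Classical in
/-- The sequence that agrees with the first one on `S` and with the second one off `S`. -/
noncomputable def splice (S : Set ℤ) (p : (ℤ → ℝ) × (ℤ → ℝ)) : ℤ → ℝ :=
  fun i => if i ∈ S then p.1 i else p.2 i

theorem measurePreserving_splice (S : Set ℤ) :
    MeasurePreserving (splice S) (seqLaw.prod seqLaw) seqLaw := by
  classical
  have hm : Measurable (splice S) := by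
    refine measurable_pi_lambda _ fun i => ?_
    by_cases h : i ∈ S
    · simp only [splice, h, if_true]; fun_prop
    · simp only [splice, h, if_false]; fun_prop
  refine ⟨hm, ?_⟩
  refine Measure.eq_infinitePi _ fun s t ht => ?_
  rw [Measure.map_apply hm (.pi s.countable_toSet fun _ _ => ht _)]
  have : splice S ⁻¹' ((s : Set ℤ).pi t) =
      (((s.filter (· ∈ S) : Finset ℤ) : Set ℤ).pi t) ×ˢ
        (((s.filter (· ∉ S) : Finset ℤ) : Set ℤ).pi t) := by
    ext p
    simp only [Set.mem_preimage, Set.mem_pi, Set.mem_prod, SetLike.mem_coe, Finset.mem_filter,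
      splice]
    constructor
    · intro h
      exact ⟨fun i hi => by simpa [hi.2] using h i hi.1, fun i hi => by simpa [hi.2] using h i hi.1⟩
    · intro h i hi
      by_cases hS : i ∈ S
      · simpa [hS] using h.1 i ⟨hi, hS⟩
      · simpa [hS] using h.2 i ⟨hi, hS⟩
  rw [this, Measure.prod_prod, seqLaw, Measure.infinitePi_pi _ fun i _ => ht i,
    Measure.infinitePi_pi _ fun i _ => ht i, Finset.prod_filter_mul_prod_filter_not]

theorem seqLaw_inter_eq_mul {B C : Set (ℤ → ℝ)} (t : ℤ) (hB : MeasurableSet B)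
    (hC : MeasurableSet C) (hBt : ∀ u u', (∀ i < t, u i = u' i) → u ∈ B → u' ∈ B)
    (hCt : ∀ u u', (∀ i, t ≤ i → u i = u' i) → u ∈ C → u' ∈ C) :
    seqLaw (B ∩ C) = seqLaw B * seqLaw C := by
  rw [← (measurePreserving_splice (Set.Iio t)).measure_preimage (hB.inter hC).nullMeasurableSet,
    ← Measure.prod_prod]
  congr 1
  ext p
  have h1 : ∀ i < t, splice (Set.Iio t) p i = p.1 i := fun i hi => by simp [splice, hi]
  have h2 : ∀ i, t ≤ i → splice (Set.Iio t) p i = p.2 i := fun i hi => by simp [splice, hi]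
  constructor
  · rintro ⟨hb, hc⟩
    exact ⟨hBt _ _ h1 hb, hCt _ _ h2 hc⟩
  · rintro ⟨hb, hc⟩
    exact ⟨hBt _ _ (fun i hi => (h1 i hi).symm) hb, hCt _ _ (fun i hi => (h2 i hi).symm) hc⟩

theorem measurePreserving_shift (t : ℤ) :
    MeasurePreserving (fun (u : ℤ → ℝ) i => u (i + t)) seqLaw seqLaw :=
  ⟨by fun_prop, Measure.map_infinitePi_infinitePi_of_inj (P := fun _ : ℤ => unif)
    (f := fun i : ℤ => i + t) (add_left_injective t)⟩

/-- If `E u t` is a property of the sequence `u t, u (t + 1), …`, its probability does not depend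
on `t`. -/
theorem seqLaw_stationary {E : (ℤ → ℝ) → ℤ → Prop} (hE : MeasurableSet {u | E u 0})
    (hcongr : ∀ {u u' : ℤ → ℝ} {t t' : ℤ}, (∀ i : ℕ, u (t + i) = u' (t' + i)) → E u t → E u' t')
    (t : ℤ) : seqLaw {u | E u t} = seqLaw {u | E u 0} := by
  rw [← (measurePreserving_shift t).measure_preimage hE.nullMeasurableSet]
  congr 1
  ext u
  exact ⟨hcongr fun i => by rw [zero_add, add_comm], hcongr fun i => by rw [zero_add, add_comm]⟩

theorem measurePreserving_update (k : ℤ) :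
    MeasurePreserving (fun p : (ℤ → ℝ) × ℝ => Function.update p.1 k p.2)
      (seqLaw.prod unif) seqLaw := by
  have hm : Measurable (fun p : (ℤ → ℝ) × ℝ => Function.update p.1 k p.2) := by
    refine measurable_pi_lambda _ fun i => ?_
    by_cases h : i = k
    · subst h; simp only [Function.update_self]; fun_prop
    · simp only [Function.update_of_ne h]; fun_prop
  refine ⟨hm, ?_⟩
  have he : MeasurePreserving (Function.eval k) seqLaw unif :=
    measurePreserving_eval_infinitePi (fun _ : ℤ => unif) k
  have h2 := (MeasurePreserving.id seqLaw).prod he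
  rw [← h2.map_eq, Measure.map_map hm h2.measurable]
  refine Eq.trans ?_ (measurePreserving_splice {k}ᶜ).map_eq
  congr 1
  funext p i
  by_cases h : i = k
  · subst h; simp [splice]
  · simp [splice, h]

/-- Changing one coordinate by a map that preserves null sets preserves null sets. -/
theorem quasiMeasurePreserving_update {f : ℝ → ℝ}
    (hf : Measure.QuasiMeasurePreserving f unif unif) (k : ℤ) :
    Measure.QuasiMeasurePreserving (fun u : ℤ → ℝ => Function.update u k (f (u k)))
      seqLaw seqLaw := by
  have hm : Measurable (fun u : ℤ → ℝ => Function.update u k (f (u k))) := by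
    refine measurable_pi_lambda _ fun i => ?_
    by_cases h : i = k
    · subst h; simp only [Function.update_self]; exact hf.measurable.comp (measurable_pi_apply _)
    · simp only [Function.update_of_ne h]; fun_prop
  refine ⟨hm, Measure.AbsolutelyContinuous.mk fun B hB hB0 => ?_⟩
  rw [Measure.map_apply hm hB]
  have hU := measurePreserving_update k
  rw [← hU.measure_preimage hB.nullMeasurableSet, Measure.measure_prod_null (hU.measurable hB)]
    at hB0
  rw [← hU.measure_preimage (hm hB).nullMeasurableSet,
    Measure.measure_prod_null (hU.measurable (hm hB))]
  filter_upwards [hB0] with u hu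
  have := hf.preimage_null hu
  simpa [Set.preimage_preimage, ← Set.preimage_comp, Function.comp_def] using this

/-- Contracting the points that satisfy some condition towards `0` preserves null sets. -/
theorem quasiMeasurePreserving_contract {s : Set ℝ} [DecidablePred (· ∈ s)] (hs : MeasurableSet s)
    {c : ℝ} (hc0 : 0 < c) (hc1 : c ≤ 1) :
    Measure.QuasiMeasurePreserving (fun v : ℝ => if v ∈ s then v else c * v) unif unif := by
  have hm : Measurable (fun v : ℝ => if v ∈ s then v else c * v) :=
    Measurable.ite hs measurable_id (measurable_const_mul c)
  refine ⟨hm, Measure.AbsolutelyContinuous.mk fun B hB hB0 => ?_⟩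
  rw [Measure.map_apply hm hB]
  rw [unif, Measure.restrict_apply hB] at hB0
  rw [unif, Measure.restrict_apply (hm hB)]
  have h1 : volume ((c * ·) ⁻¹' (B ∩ Set.Ico 0 1)) = 0 := by
    rw [Real.volume_preimage_mul_left hc0.ne', hB0, mul_zero]
  refine measure_mono_null ?_ (measure_union_null hB0 h1)
  rintro v ⟨hv, hv0, hv1⟩
  simp only [Set.mem_preimage] at hv
  split_ifs at hv with h
  · exact Or.inl ⟨hv, hv0, hv1⟩
  · exact Or.inr ⟨hv, by positivity, by nlinarith⟩

theorem seqLaw_ae_mem : ∀ᵐ u ∂seqLaw, ∀ i, u i ∈ Set.Ico (0 : ℝ) 1 := by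
  rw [ae_all_iff]
  intro i
  have h : ∀ᵐ v ∂unif, v ∈ Set.Ico (0 : ℝ) 1 := ae_restrict_mem measurableSet_Ico
  exact (measurePreserving_eval_infinitePi (fun _ : ℤ => unif) i).quasiMeasurePreserving.ae h

/-! ### Locality and measurability of the coalescence events -/

section Local

variable {A : Type*} {F : Past A → ℝ → A} {u u' : ℤ → ℝ} {t t' : ℤ}

theorem word_congr {n : ℕ} (h : ∀ i < n, u (t + i) = u' (t' + i)) (x : Past A) :
    word F u t x n = word F u' t' x n := by
  induction n with
  | zero => rfl
  | succ n ih =>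
    rw [word, word, ih fun i hi => h i (hi.trans (Nat.lt_succ_self n)), h n (Nat.lt_succ_self n)]

theorem Yields.congr {w : List A} (h : ∀ i < w.length, u (t + i) = u' (t' + i))
    (hy : Yields F u t w) : Yields F u' t' w :=
  fun x => by rw [← word_congr h, hy x]

theorem Coalesces.congr {n : ℕ} (h : ∀ i < n, u (t + i) = u' (t' + i))
    (hy : Coalesces F u t n) : Coalesces F u' t' n := by
  obtain ⟨w, rfl, hw⟩ := hy
  exact ⟨w, rfl, hw.congr h⟩

theorem IsCycle.congr {w : List A} (h : ∀ i < w.length, u (t + i) = u' (t' + i))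
    (hy : IsCycle F u t w) : IsCycle F u' t' w := by
  refine ⟨hy.1, hy.2.1.congr (by simpa using h), fun k hk0 hk hc => hy.2.2 k hk0 hk ?_⟩
  refine hc.congr fun i hi => ?_
  have := h (k + i) (by omega)
  push_cast at this
  rw [add_assoc, add_assoc, this]

theorem IsRegenTime.congr [Nonempty A] (h : ∀ i : ℕ, u (t + i) = u' (t' + i))
    (hy : IsRegenTime F u t) : IsRegenTime F u' t' := by
  rw [isRegenTime_iff] at hy ⊢
  exact fun n => (hy n).congr fun i _ => h i

theorem StartsWith.congr [Nonempty A] {ws : List (List A)} (h : ∀ i : ℕ, u (t + i) = u' (t' + i))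
    (hy : StartsWith F u ws t) : StartsWith F u' ws t' := by
  induction ws generalizing t t' with
  | nil => exact IsRegenTime.congr h hy
  | cons w ws ih =>
    refine ⟨hy.1.congr fun i _ => h i, ih (fun i => ?_) hy.2⟩
    have := h (w.length + i)
    push_cast at this
    rw [add_assoc, add_assoc, this]

end Local

section Measurability

variable {A : Type*} [Encodable A] [Nonempty A] (P : Ker A)

theorem measurableSet_yields (t : ℤ) (w : List A) :
    MeasurableSet {u | Yields (update P) u t w} := by
  induction w with
  | nil => simp [yields_nil]
  | cons a w ih =>
    have h : MeasurableSet ((fun u : ℤ → ℝ => u (t + w.length)) ⁻¹'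
        {v | ∀ x, update P (glue w x) v = a}) :=
      measurable_pi_apply _ (measurableSet_forall_update P (fun x => glue w x) a)
    simp only [yields_cons, Set.ofPred_and]
    exact ih.inter h

theorem measurableSet_coalesces (t : ℤ) (n : ℕ) :
    MeasurableSet {u | Coalesces (update P) u t n} := by
  simp only [Coalesces, Set.ofPred_exists]
  exact MeasurableSet.iUnion fun w => (MeasurableSet.const _).inter (measurableSet_yields P t w)

theorem measurableSet_isRegenTime (t : ℤ) : MeasurableSet {u | IsRegenTime (update P) u t} := by
  simp only [isRegenTime_iff, Set.ofPred_forall]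
  exact MeasurableSet.iInter fun n => measurableSet_coalesces P t n

theorem measurableSet_isCycle (t : ℤ) (w : List A) :
    MeasurableSet {u | IsCycle (update P) u t w} := by
  have : {u | IsCycle (update P) u t w} = {_u | w ≠ []} ∩ ({u | Yields (update P) u t w.reverse} ∩
      ⋂ k : ℕ, ⋂ _ : 0 < k, ⋂ _ : k < w.length,
        {u | Coalesces (update P) u (t + k) (w.length - k)}ᶜ) := by
    ext u; simp [IsCycle]
  rw [this]
  exact (MeasurableSet.const _).inter ((measurableSet_yields P t _).inter
    (MeasurableSet.iInter fun k => MeasurableSet.iInter fun _ => MeasurableSet.iInter fun _ =>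
      (measurableSet_coalesces P _ _).compl))

theorem measurableSet_startsWith (ws : List (List A)) (t : ℤ) :
    MeasurableSet {u | StartsWith (update P) u ws t} := by
  induction ws generalizing t with
  | nil => exact measurableSet_isRegenTime P t
  | cons w ws ih => exact (measurableSet_isCycle P t w).inter (ih _)

end Measurability

/-! ### Safe times -/

section SafeProb

variable {A : Type*} [Encodable A] {P : Ker A} {τ : Set (Str A)} {u u' : ℤ → ℝ} {t t' : ℤ}

theorem KnownContext.congr {n m : ℕ} (h : ∀ i < n, u (t + i) = u' (t' + i))
    (hK : KnownContext P τ u t n m) : KnownContext P τ u' t' n m := by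
  refine fun x hx => hK x fun i hi a ha => hx i hi a ?_
  have h1 := h (n - 1 - i) (by omega)
  have e : ∀ t : ℤ, t + n - 1 - i = t + ((n - 1 - i : ℕ) : ℤ) := fun t => by omega
  rwa [e, ← h1, ← e]

theorem Safe.congr {n : ℕ} (h : ∀ i ≤ n, u (t + i) = u' (t' + i))
    (hS : Safe P τ u t n) : Safe P τ u' t' n := by
  unfold Safe at hS ⊢
  rw [h n le_rfl] at hS
  refine hS.imp_right ?_
  rintro ⟨k, m, hmk, hK, hlt⟩
  exact ⟨k, m, hmk, hK.congr fun i hi => h i hi.le, hlt⟩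

variable (P τ)

/-- All times from `t` on are safe when started from `t`. Such a `t` is a regeneration time. -/
def AlwaysSafe (u : ℤ → ℝ) (t : ℤ) : Prop := ∀ n, Safe P τ u t n

/-- The first time that is not safe when started from `t` is `t + j`. -/
def FirstUnsafe (j : ℕ) (u : ℤ → ℝ) (t : ℤ) : Prop :=
  (∀ n < j, Safe P τ u t n) ∧ ¬ Safe P τ u t j

/-- None of the first `M` times from `t` on is always safe; `M` may be infinite. -/
def NoAlwaysSafe (M : ℕ∞) (u : ℤ → ℝ) (t : ℤ) : Prop :=
  ∀ s : ℕ, (s : ℕ∞) < M → ¬ AlwaysSafe P τ u (t + s)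

theorem measurableSet_knownContext (t : ℤ) (n m : ℕ) :
    MeasurableSet {u | KnownContext P τ u t n m} := by
  have : {u | KnownContext P τ u t n m} =
      ⋃ y : {y : Fin n → Option A //
          ∀ x : Past A, (∀ i a, y i = some a → x i = a) → contextLen τ x ≤ m},
        ⋂ i : Fin n, {u : ℤ → ℝ | spontaneous P (u (t + n - 1 - (i : ℕ))) = y.1 i} := by
    ext u
    simp only [Set.mem_iUnion, Set.mem_iInter, Set.mem_ofPred_eq, Subtype.exists, exists_prop]
    constructor
    · intro h
      exact ⟨fun i => spontaneous P (u (t + n - 1 - (i : ℕ))),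
        fun x hx => h x fun i hi a ha => hx ⟨i, hi⟩ a ha, fun i => rfl⟩
    · rintro ⟨y, hy, huy⟩ x hx
      exact hy x fun i a ha => hx i i.2 a ((huy i).trans ha)
  rw [this]
  refine MeasurableSet.iUnion fun y => MeasurableSet.iInter fun i => ?_
  have h : MeasurableSet ((fun u : ℤ → ℝ => u (t + n - 1 - (i : ℕ))) ⁻¹'
      {v | spontaneous P v = y.1 i}) :=
    measurable_pi_apply _ (measurableSet_spontaneous P (y.1 i))
  exact h

theorem measurableSet_isSome_spontaneous (t : ℤ) :
    MeasurableSet {u : ℤ → ℝ | (spontaneous P (u t)).isSome} := by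
  simp only [isSome_spontaneous]
  exact measurableSet_lt (ENNReal.measurable_ofReal.comp (measurable_pi_apply t)) measurable_const

theorem measurableSet_safe (t : ℤ) (n : ℕ) : MeasurableSet {u | Safe P τ u t n} := by
  have : {u | Safe P τ u t n} = {u : ℤ → ℝ | (spontaneous P (u (t + n))).isSome} ∪
      ⋃ k : ℕ, ⋃ m : ℕ, ⋃ _ : m + k ≤ n, {u | KnownContext P τ u t n m} ∩
        {u : ℤ → ℝ | ENNReal.ofReal (u (t + n)) < alphaLen P τ k m} := by
    ext u
    simp only [Safe, Set.mem_union, Set.mem_iUnion, Set.mem_inter_iff, Set.mem_ofPred_eq,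
      exists_prop]
  rw [this]
  exact (measurableSet_isSome_spontaneous P _).union (MeasurableSet.iUnion fun k =>
    MeasurableSet.iUnion fun m => MeasurableSet.iUnion fun _ =>
      (measurableSet_knownContext P τ t n m).inter
        (measurableSet_lt (ENNReal.measurable_ofReal.comp (measurable_pi_apply _))
          measurable_const))

theorem measurableSet_alwaysSafe (t : ℤ) : MeasurableSet {u | AlwaysSafe P τ u t} := by
  simp only [AlwaysSafe, Set.ofPred_forall]
  exact MeasurableSet.iInter fun n => measurableSet_safe P τ t n

theorem measurableSet_firstUnsafe (j : ℕ) (t : ℤ) : MeasurableSet {u | FirstUnsafe P τ j u t} := by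
  have : {u | FirstUnsafe P τ j u t} =
      (⋂ n : ℕ, ⋂ _ : n < j, {u | Safe P τ u t n}) ∩ {u | Safe P τ u t j}ᶜ := by
    ext u; simp [FirstUnsafe]
  rw [this]
  exact (MeasurableSet.iInter fun n => MeasurableSet.iInter fun _ =>
    measurableSet_safe P τ t n).inter (measurableSet_safe P τ t j).compl

theorem measurableSet_noAlwaysSafe (M : ℕ∞) (t : ℤ) :
    MeasurableSet {u | NoAlwaysSafe P τ M u t} := by
  have : {u | NoAlwaysSafe P τ M u t} =
      ⋂ s : ℕ, ⋂ _ : (s : ℕ∞) < M, {u | AlwaysSafe P τ u (t + s)}ᶜ := by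
    ext u; simp [NoAlwaysSafe]
  rw [this]
  exact MeasurableSet.iInter fun s => MeasurableSet.iInter fun _ =>
    (measurableSet_alwaysSafe P τ _).compl

variable {P τ}

theorem AlwaysSafe.congr (h : ∀ i : ℕ, u (t + i) = u' (t' + i)) (hS : AlwaysSafe P τ u t) :
    AlwaysSafe P τ u' t' := fun n => (hS n).congr fun i _ => h i

theorem NoAlwaysSafe.congr {M : ℕ∞} (h : ∀ i : ℕ, u (t + i) = u' (t' + i))
    (hS : NoAlwaysSafe P τ M u t) : NoAlwaysSafe P τ M u' t' := by
  refine fun s hs hA => hS s hs (hA.congr fun i => ?_)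
  have := h (s + i)
  push_cast at this
  rw [add_assoc, add_assoc, this]

theorem FirstUnsafe.congr {j : ℕ} (h : ∀ i ≤ j, u (t + i) = u' (t' + i))
    (hS : FirstUnsafe P τ j u t) : FirstUnsafe P τ j u' t' :=
  ⟨fun n hn => (hS.1 n hn).congr fun i hi => h i (hi.trans hn.le),
    fun hs => hS.2 (hs.congr fun i hi => (h i hi).symm)⟩

theorem NoAlwaysSafe.exists_firstUnsafe {M : ℕ∞} (hM : 0 < M) (h : NoAlwaysSafe P τ M u t) :
    ∃ j : ℕ, FirstUnsafe P τ j u t ∧ NoAlwaysSafe P τ (M - (j + 1 : ℕ)) u (t + (j + 1 : ℕ)) := by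
  classical
  have h0 := h 0 hM
  rw [Nat.cast_zero, add_zero] at h0
  have hex : ∃ n, ¬ Safe P τ u t n := by simpa [AlwaysSafe] using h0
  refine ⟨Nat.find hex, ⟨fun n hn => not_not.1 (Nat.find_min hex hn), Nat.find_spec hex⟩,
    fun s hs => ?_⟩
  rw [add_assoc, ← Nat.cast_add]
  refine h _ ?_
  rw [lt_tsub_iff_left] at hs
  exact_mod_cast hs

/-- The chance that no starting time among the first `M` is always safe satisfies a renewal
inequality: the window inspected until the first failure is independent of what follows. -/
theorem seqLaw_noAlwaysSafe_le {M : ℕ∞} (hM : 0 < M) :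
    seqLaw {u | NoAlwaysSafe P τ M u 0} ≤ ∑' j : ℕ, seqLaw {u | FirstUnsafe P τ j u 0} *
      seqLaw {u | NoAlwaysSafe P τ (M - (j + 1 : ℕ)) u 0} := by
  have hsub : {u | NoAlwaysSafe P τ M u 0} ⊆ ⋃ j : ℕ, ({u | FirstUnsafe P τ j u 0} ∩
      {u | NoAlwaysSafe P τ (M - (j + 1 : ℕ)) u (j + 1 : ℕ)}) := by
    intro u hu
    obtain ⟨j, h1, h2⟩ := NoAlwaysSafe.exists_firstUnsafe hM hu
    rw [zero_add] at h2
    exact Set.mem_iUnion.2 ⟨j, h1, h2⟩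
  refine (measure_mono hsub).trans ((measure_iUnion_le _).trans
    (ENNReal.tsum_le_tsum fun j => ?_))
  rw [seqLaw_inter_eq_mul ((j + 1 : ℕ) : ℤ) (measurableSet_firstUnsafe P τ j 0)
    (measurableSet_noAlwaysSafe P τ _ _)
    (fun u u' h hu => FirstUnsafe.congr (fun i hi => h _ (by omega)) hu)
    (fun u u' h hu => NoAlwaysSafe.congr (fun i => h _ (by omega)) hu),
    seqLaw_stationary (measurableSet_noAlwaysSafe P τ _ 0) NoAlwaysSafe.congr]

theorem tsum_firstUnsafe :
    ∑' j : ℕ, seqLaw {u | FirstUnsafe P τ j u 0} = 1 - seqLaw {u | AlwaysSafe P τ u 0} := by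
  classical
  rw [← prob_compl_eq_one_sub (measurableSet_alwaysSafe P τ 0), ← measure_iUnion]
  · congr 1
    ext u
    simp only [Set.mem_iUnion, Set.mem_ofPred_eq, Set.mem_compl_iff, AlwaysSafe, not_forall]
    constructor
    · rintro ⟨j, hj⟩
      exact ⟨j, hj.2⟩
    · intro hex
      exact ⟨Nat.find hex, fun n hn => not_not.1 (Nat.find_min hex hn), Nat.find_spec hex⟩
  · intro i j hij
    rw [Function.onFun, Set.disjoint_left]
    intro u hi hj
    rcases lt_or_gt_of_ne hij with h | h
    · exact hi.2 (hj.1 i h)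
    · exact hj.2 (hi.1 j h)
  · exact fun j => measurableSet_firstUnsafe P τ j 0

/-- If the times `n` are unsafe with summable probabilities, then with positive probability all
times are safe. All but the first `N` times are safe with positive probability, and a contraction
of the values at the first `N` times that turns each `⋆` into a symbol keeps the later times safe:
it can only shorten the contexts. -/
theorem seqLaw_alwaysSafe_pos [Nonempty A] (hnull : WeaklyNonNull P)
    (hsum : ∑' n : ℕ, seqLaw {u | ¬ Safe P τ u 0 n} ≠ ⊤) :
    0 < seqLaw {u | AlwaysSafe P τ u 0} := by
  classical
  obtain ⟨N, hN⟩ : ∃ N, ∑' n : ℕ, seqLaw {u | ¬ Safe P τ u 0 (n + N)} < 1 :=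
    ((ENNReal.tendsto_sum_nat_add _ hsum).eventually (gt_mem_nhds zero_lt_one)).exists
  have hE : MeasurableSet {u | ∀ n, Safe P τ u 0 (n + N)} := by
    simp only [Set.ofPred_forall]
    exact MeasurableSet.iInter fun n => measurableSet_safe P τ 0 (n + N)
  have hEpos : 0 < seqLaw {u | ∀ n, Safe P τ u 0 (n + N)} := by
    have h1 : seqLaw {u | ∀ n, Safe P τ u 0 (n + N)}ᶜ < 1 := by
      refine lt_of_le_of_lt (le_trans (measure_mono ?_) (measure_iUnion_le _)) hN
      intro u hu
      simpa using hu
    rw [pos_iff_ne_zero]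
    intro h0
    rw [prob_compl_eq_one_sub hE, h0, tsub_zero] at h1
    exact lt_irrefl _ h1
  set B : ℕ → Set (ℤ → ℝ) := fun k => {u | (∀ n, Safe P τ u 0 (n + N)) ∧
    (∀ i, u i ∈ Set.Ico (0 : ℝ) 1) ∧ ∀ i : ℕ, i < k → (spontaneous P (u i)).isSome} with hB
  have hα1 := alphaNeg_le_one P
  have hα_top : alphaNeg P ≠ ⊤ := ne_top_of_le_ne_top ENNReal.one_ne_top hα1
  set c := (alphaNeg P).toReal with hc
  have hc0 : 0 < c := ENNReal.toReal_pos (ne_of_gt hnull) hα_top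
  have hc1 : c ≤ 1 := by simpa using ENNReal.toReal_mono ENNReal.one_ne_top hα1
  have key : ∀ k, 0 < seqLaw (B k) := by
    intro k
    induction k with
    | zero =>
      refine hEpos.trans_le (measure_mono_ae ?_)
      filter_upwards [seqLaw_ae_mem] with u hu hS
      exact ⟨hS, hu, fun i hi => absurd hi (Nat.not_lt_zero i)⟩
    | succ k ih =>
      set s : Set ℝ := {v | ENNReal.ofReal v < alphaNeg P} with hs
      have hsm : MeasurableSet s := measurableSet_lt ENNReal.measurable_ofReal measurable_const
      have hq := quasiMeasurePreserving_update (quasiMeasurePreserving_contract hsm hc0 hc1) k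
      by_contra hcon
      have h0 := hq.preimage_null (nonpos_iff_eq_zero.1 (not_lt.1 hcon))
      refine ih.ne' (measure_mono_null (fun u hu => ?_) h0)
      obtain ⟨h1, h2, h3⟩ := hu
      set r : ℝ := if u k ∈ s then u k else c * u k with hr
      have hrm : r ∈ Set.Ico (0 : ℝ) 1 := by
        have := h2 k
        rw [hr]
        split_ifs
        · exact this
        · exact ⟨mul_nonneg hc0.le this.1, by nlinarith [this.1, this.2]⟩
      have hrs : (spontaneous P r).isSome := by
        rw [isSome_spontaneous, hr]
        split_ifs with h
        · exact h
        · rw [ENNReal.ofReal_lt_iff_lt_toReal (mul_nonneg hc0.le (h2 k).1) hα_top]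
          nlinarith [(h2 k).2]
      have href : Refines P (Function.update u (k : ℤ) r) u := by
        intro j
        by_cases hj : j = k
        · subst hj
          rw [Function.update_self]
          by_cases h : u k ∈ s
          · left; rw [hr, if_pos h]
          · right
            refine ⟨?_, hrs⟩
            rw [← Option.not_isSome_iff_eq_none, isSome_spontaneous]
            exact h
        · left; rw [Function.update_of_ne hj]
      change Function.update u (k : ℤ) r ∈ B (k + 1)
      refine ⟨fun n => (h1 n).of_refines href, fun i => ?_, fun i hi => ?_⟩
      · by_cases hj : i = k
        · subst hj; rw [Function.update_self]; exact hrm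
        · rw [Function.update_of_ne hj]; exact h2 i
      · by_cases hj : i = k
        · subst hj; rw [Function.update_self]; exact hrs
        · rw [Function.update_of_ne (by exact_mod_cast hj)]; exact h3 i (by omega)
  refine (key N).trans_le (measure_mono fun u hu n => ?_)
  obtain ⟨h1, -, h3⟩ := hu
  rcases lt_or_ge n N with h | h
  · left; rw [zero_add]; exact h3 n h
  · have := h1 (n - N)
    rwa [Nat.sub_add_cancel h] at this

theorem seqLaw_noAlwaysSafe_top (hpos : 0 < seqLaw {u | AlwaysSafe P τ u 0}) :
    seqLaw {u | NoAlwaysSafe P τ ⊤ u 0} = 0 := by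
  have h := seqLaw_noAlwaysSafe_le (P := P) (τ := τ) (M := ⊤) (by simp)
  simp only [ENat.top_sub_natCast] at h
  rw [ENNReal.tsum_mul_right, tsum_firstUnsafe] at h
  by_contra hne
  have hlt : 1 - seqLaw {u | AlwaysSafe P τ u 0} < 1 :=
    ENNReal.sub_lt_self ENNReal.one_ne_top one_ne_zero hpos.ne'
  have := ENNReal.mul_lt_mul_left hne (measure_ne_top _ _) hlt
  rw [one_mul] at this
  exact absurd h (not_le.2 this)

theorem ae_exists_alwaysSafe_ge (hpos : 0 < seqLaw {u | AlwaysSafe P τ u 0}) (t : ℤ) :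
    ∀ᵐ u ∂seqLaw, ∃ s ≥ t, AlwaysSafe P τ u s := by
  have h : seqLaw {u | NoAlwaysSafe P τ ⊤ u t} = 0 := by
    rw [seqLaw_stationary (measurableSet_noAlwaysSafe P τ _ 0) NoAlwaysSafe.congr,
      seqLaw_noAlwaysSafe_top hpos]
  filter_upwards [measure_eq_zero_iff_ae_notMem.1 h] with u hu
  simp only [NoAlwaysSafe, not_forall, not_not] at hu
  obtain ⟨s, -, hs⟩ := hu
  exact ⟨t + s, by omega, hs⟩

theorem ae_exists_alwaysSafe_lt (hpos : 0 < seqLaw {u | AlwaysSafe P τ u 0}) (t : ℤ) :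
    ∀ᵐ u ∂seqLaw, ∃ s < t, AlwaysSafe P τ u s := by
  have hlim : Tendsto (fun M : ℕ => seqLaw {u | NoAlwaysSafe P τ M u 0}) atTop (𝓝 0) := by
    have h1 : ⋂ M : ℕ, {u | NoAlwaysSafe P τ M u 0} = {u | NoAlwaysSafe P τ ⊤ u 0} := by
      ext u
      simp only [Set.mem_iInter, Set.mem_ofPred_eq]
      refine ⟨fun h s _ => h (s + 1) s ?_, fun h M s _ => h s (by simp)⟩
      exact_mod_cast Nat.lt_succ_self s
    rw [← seqLaw_noAlwaysSafe_top hpos, ← h1]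
    refine tendsto_measure_iInter_atTop
      (fun M => (measurableSet_noAlwaysSafe P τ _ _).nullMeasurableSet) ?_
      ⟨0, measure_ne_top _ _⟩
    intro M M' hM u hu s hs
    exact hu s (hs.trans_le (by exact_mod_cast hM))
  have hzero : seqLaw {u | ∀ s < t, ¬ AlwaysSafe P τ u s} = 0 := by
    refine le_antisymm (ge_of_tendsto' hlim fun M => ?_) bot_le
    rw [← seqLaw_stationary (measurableSet_noAlwaysSafe P τ _ 0) NoAlwaysSafe.congr (t - M)]
    refine measure_mono fun u hu s hs => hu _ ?_
    have : s < M := by exact_mod_cast hs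
    omega
  filter_upwards [measure_eq_zero_iff_ae_notMem.1 hzero] with u hu
  simpa using hu

end SafeProb

/-! ### Exponential decay -/

theorem ExpDecay.mono {c c' : ℕ → ℝ≥0∞} (h : ExpDecay c) (hle : ∀ n, c' n ≤ c n) :
    ExpDecay c' := by
  obtain ⟨D, d, hD, hd0, hd1, hc⟩ := h
  exact ⟨D, d, hD, hd0, hd1, fun n => (hle n).trans (hc n)⟩

theorem ExpDecay.add {c c' : ℕ → ℝ≥0∞} (h : ExpDecay c) (h' : ExpDecay c') :
    ExpDecay fun n => c n + c' n := by
  obtain ⟨D, d, hD, hd0, hd1, hc⟩ := h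
  obtain ⟨D', d', hD', hd0', hd1', hc'⟩ := h'
  refine ⟨D + D', max d d', by positivity, lt_max_of_lt_left hd0, max_lt hd1 hd1', fun n => ?_⟩
  rw [add_mul, ENNReal.ofReal_add (by positivity) (by positivity)]
  refine add_le_add ((hc n).trans (ENNReal.ofReal_le_ofReal ?_))
    ((hc' n).trans (ENNReal.ofReal_le_ofReal ?_))
  · gcongr; exact le_max_left _ _
  · gcongr; exact le_max_right _ _

theorem ExpDecay.const_mul {c : ℕ → ℝ≥0∞} (h : ExpDecay c) {K : ℝ≥0∞} (hK : K ≠ ⊤) :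
    ExpDecay fun n => K * c n := by
  obtain ⟨D, d, hD, hd0, hd1, hc⟩ := h
  refine ⟨(K.toReal + 1) * D, d, by positivity, hd0, hd1, fun n => ?_⟩
  rw [mul_assoc, ENNReal.ofReal_mul (by positivity)]
  refine mul_le_mul' ?_ (hc n)
  rw [← ENNReal.ofReal_toReal hK]
  exact ENNReal.ofReal_le_ofReal (by simp)

theorem ExpDecay.half {c : ℕ → ℝ≥0∞} (h : ExpDecay c) : ExpDecay fun n => c (n / 2) := by
  obtain ⟨D, d, hD, hd0, hd1, hc⟩ := h
  have hs0 : 0 < √d := Real.sqrt_pos.2 hd0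
  have hs1 : √d < 1 := by rw [Real.sqrt_lt' one_pos]; simpa using hd1
  refine ⟨D / √d, √d, by positivity, hs0, hs1, fun n => (hc (n / 2)).trans
    (ENNReal.ofReal_le_ofReal ?_)⟩
  have h1 : d ^ (n / 2) * √d = √d ^ (2 * (n / 2) + 1) := by
    rw [pow_succ, pow_mul, Real.sq_sqrt hd0.le]
  have h2 : √d ^ (2 * (n / 2) + 1) ≤ √d ^ n := pow_le_pow_of_le_one hs0.le hs1.le (by omega)
  rw [div_mul_eq_mul_div, le_div_iff₀ hs0, mul_assoc, h1]
  gcongr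

theorem ExpDecay.tsum_ne_top {c : ℕ → ℝ≥0∞} (h : ExpDecay c) : ∑' n, c n ≠ ⊤ := by
  obtain ⟨D, d, hD, hd0, hd1, hc⟩ := h
  refine ne_top_of_le_ne_top ?_ (ENNReal.tsum_le_tsum hc)
  exact ((summable_geometric_of_lt_one hd0.le hd1).mul_left D).tsum_ofReal_ne_top

theorem tsum_half (f : ℕ → ℝ≥0∞) : ∑' n, f (n / 2) = ∑' n, f n + ∑' n, f n := by
  rw [← tsum_even_add_odd (f := fun n => f (n / 2)) ENNReal.summable ENNReal.summable]
  congr 1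
  · exact tsum_congr fun n => by simp
  · exact tsum_congr fun n => by congr 1; omega

/-- If `φ` is defective, `∑ φ j < 1`, and decays exponentially, then so do the solutions of the
renewal inequality `g n ≤ ∑ j, φ j * g (n - (j + 1))`: some `s > 1` satisfies
`∑ φ j * s ^ (j + 1) ≤ 1`, and then `g n ≤ s⁻¹ ^ n` by induction. -/
theorem expDecay_of_renewal {φ g : ℕ → ℝ≥0∞} (hφ : ExpDecay φ) (hφ1 : ∑' j, φ j < 1)
    (hg0 : g 0 ≤ 1) (hg : ∀ n, 0 < n → g n ≤ ∑' j, φ j * g (n - (j + 1))) : ExpDecay g := by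
  obtain ⟨s, hs1, hs⟩ : ∃ s : ℝ, 1 < s ∧ ∑' j, φ j * ENNReal.ofReal s ^ (j + 1) ≤ 1 := by
    obtain ⟨D, d, hD, hd0, hd1, hc⟩ := hφ
    have hq0 : 0 < √d := Real.sqrt_pos.2 hd0
    have hq1 : √d < 1 := by rw [Real.sqrt_lt' one_pos]; simpa using hd1
    have hfin : ∀ j, φ j ≠ ⊤ := fun j => ne_top_of_le_ne_top ENNReal.ofReal_ne_top (hc j)
    have hreal : ∀ j, (φ j).toReal ≤ D * d ^ j := fun j =>
      ENNReal.toReal_le_of_le_ofReal (by positivity) (hc j)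
    have hbound : ∀ s : ℝ, 0 < s → s < (√d)⁻¹ → ∀ j,
        (φ j).toReal * s ^ (j + 1) ≤ D * (√d)⁻¹ * √d ^ j := by
      intro s hs0 hs j
      calc (φ j).toReal * s ^ (j + 1) ≤ (D * d ^ j) * (√d)⁻¹ ^ (j + 1) := by
            gcongr; exact hreal j
        _ = D * (√d)⁻¹ * √d ^ j := by
            have : d ^ j = √d ^ j * √d ^ j := by
              rw [← mul_pow, Real.mul_self_sqrt hd0.le]
            rw [this, inv_pow, pow_succ]
            field_simp
    have hsummable : Summable fun j => D * (√d)⁻¹ * √d ^ j :=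
      (summable_geometric_of_lt_one hq0.le hq1).mul_left _
    have hlim : Tendsto (fun s : ℝ => ∑' j, (φ j).toReal * s ^ (j + 1)) (𝓝 1)
        (𝓝 (∑' j, (φ j).toReal * 1 ^ (j + 1))) := by
      refine tendsto_tsum_of_dominated_convergence hsummable (fun j => ?_) ?_
      · exact (Continuous.tendsto (by fun_prop) 1)
      · have : Set.Ioo (0 : ℝ) (√d)⁻¹ ∈ 𝓝 (1 : ℝ) :=
          Ioo_mem_nhds one_pos ((one_lt_inv₀ hq0).2 hq1)
        filter_upwards [this] with s hs j
        rw [Real.norm_of_nonneg (mul_nonneg ENNReal.toReal_nonneg (pow_nonneg hs.1.le _))]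
        exact hbound s hs.1 hs.2 j
    have hlt : ∑' j, (φ j).toReal * 1 ^ (j + 1) < 1 := by
      simp only [one_pow, mul_one]
      rw [← ENNReal.tsum_toReal_eq hfin]
      exact ENNReal.toReal_lt_of_lt_ofReal (by simpa using hφ1)
    have hev := hlim.eventually (gt_mem_nhds hlt)
    have hev2 : ∀ᶠ s : ℝ in 𝓝 1, s < (√d)⁻¹ := gt_mem_nhds ((one_lt_inv₀ hq0).2 hq1)
    obtain ⟨s, ⟨h1, h2⟩, h3⟩ :=
      (((hev.and hev2).filter_mono nhdsWithin_le_nhds).and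
        (self_mem_nhdsWithin : Set.Ioi (1 : ℝ) ∈ 𝓝[>] (1 : ℝ))).exists
    have hs0 : 0 < s := one_pos.trans h3
    refine ⟨s, h3, ?_⟩
    have hterm : ∀ j, φ j * ENNReal.ofReal s ^ (j + 1) =
        ENNReal.ofReal ((φ j).toReal * s ^ (j + 1)) := by
      intro j
      rw [ENNReal.ofReal_mul ENNReal.toReal_nonneg, ENNReal.ofReal_toReal (hfin j),
        ENNReal.ofReal_pow hs0.le]
    simp only [hterm]
    rw [← ENNReal.ofReal_tsum_of_nonneg
      (fun j => mul_nonneg ENNReal.toReal_nonneg (pow_nonneg hs0.le _))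
      (Summable.of_nonneg_of_le
        (fun j => mul_nonneg ENNReal.toReal_nonneg (pow_nonneg hs0.le _)) (hbound s hs0 h2)
        hsummable)]
    exact ENNReal.ofReal_le_one.2 h1.le
  have hs0 : 0 < s := one_pos.trans hs1
  refine ⟨1, s⁻¹, one_pos, inv_pos.2 hs0, inv_lt_one_of_one_lt₀ hs1, fun n => ?_⟩
  rw [one_mul, ENNReal.ofReal_pow (inv_pos.2 hs0).le]
  have hqs : ENNReal.ofReal s⁻¹ * ENNReal.ofReal s = 1 := by
    rw [← ENNReal.ofReal_mul (inv_pos.2 hs0).le, inv_mul_cancel₀ hs0.ne', ENNReal.ofReal_one]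
  have hS1 : 1 ≤ ENNReal.ofReal s := by simpa using hs1.le
  set q := ENNReal.ofReal s⁻¹
  set S := ENNReal.ofReal s
  induction n using Nat.strong_induction_on with
  | _ n ih =>
    rcases Nat.eq_zero_or_pos n with rfl | hn
    · simpa using hg0
    have hstep : ∀ j, q ^ (n - (j + 1)) ≤ S ^ (j + 1) * q ^ n := by
      intro j
      rcases le_total (j + 1) n with h | h
      · have : q ^ n = q ^ (j + 1) * q ^ (n - (j + 1)) := by rw [← pow_add]; congr 1; omega
        rw [this, ← mul_assoc, ← mul_pow, mul_comm S, hqs, one_pow, one_mul]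
      · have : S ^ (j + 1) = S ^ (j + 1 - n) * S ^ n := by rw [← pow_add]; congr 1; omega
        rw [Nat.sub_eq_zero_of_le h, pow_zero, this, mul_assoc, ← mul_pow, mul_comm S q, hqs,
          one_pow, mul_one]
        exact one_le_pow_of_one_le' hS1 _
    calc g n ≤ ∑' j, φ j * g (n - (j + 1)) := hg n hn
      _ ≤ ∑' j, φ j * S ^ (j + 1) * q ^ n := by
          refine ENNReal.tsum_le_tsum fun j => ?_
          rw [mul_assoc]
          gcongr
          exact (ih _ (by omega)).trans (hstep j)
      _ ≤ q ^ n := by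
          rw [ENNReal.tsum_mul_right]
          exact mul_le_of_le_one_left' hs

theorem expDecay_noAlwaysSafe {A : Type*} [Encodable A] {P : Ker A} {τ : Set (Str A)}
    (hpos : 0 < seqLaw {u | AlwaysSafe P τ u 0})
    (h : ExpDecay fun n => seqLaw {u | ¬ Safe P τ u 0 n}) :
    ExpDecay fun n : ℕ => seqLaw {u | NoAlwaysSafe P τ n u 0} := by
  refine expDecay_of_renewal (φ := fun j => seqLaw {u | FirstUnsafe P τ j u 0})
    (h.mono fun j => measure_mono fun u hu => hu.2) ?_ prob_le_one fun n hn => ?_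
  · rw [tsum_firstUnsafe]
    exact ENNReal.sub_lt_self ENNReal.one_ne_top one_ne_zero hpos.ne'
  · refine (seqLaw_noAlwaysSafe_le (by exact_mod_cast hn)).trans_eq (tsum_congr fun j => ?_)
    rw [← ENat.natCast_sub]

/-! ### The probability of an unsafe time -/

section Rates

variable {A : Type*} [Encodable A] {P : Ker A} {τ : Set (Str A)}
  {Ω : Type*} [MeasurableSpace Ω] {μ : Measure Ω} {U : ℤ → Ω → ℝ}

theorem map_eq_seqLaw [IsProbabilityMeasure μ] (hUmeas : ∀ i, Measurable (U i))
    (hUindep : iIndepFun U μ) (hUunif : ∀ i, μ.map (U i) = volume.restrict (Set.Ico (0 : ℝ) 1)) :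
    MeasurePreserving (fun ω i => U i ω) μ seqLaw := by
  refine ⟨measurable_pi_lambda _ hUmeas, ?_⟩
  rw [(iIndepFun_iff_map_fun_eq_infinitePi_map hUmeas).1 hUindep, seqLaw]
  simp only [hUunif, unif]

theorem alphaNeg_le_alphaLen {A : Type*} {P : Ker A} {τ : Set (Str A)} (k : ℕ) (i : ℕ∞) :
    alphaNeg P ≤ alphaLen P τ k i := by
  refine le_iInf₂ fun v _ => le_iInf₂ fun w _ => ?_
  rw [alphaNeg_eq]
  exact ENNReal.tsum_le_tsum fun a => infProb_le_append P [] (v ++ w) a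

theorem unif_ofReal_eq (a : ℝ≥0∞) : unif {v | ENNReal.ofReal v = a} = 0 := by
  have hm : MeasurableSet {v : ℝ | ENNReal.ofReal v = a} :=
    ENNReal.measurable_ofReal (measurableSet_singleton a)
  rw [unif, Measure.restrict_apply hm]
  refine measure_mono_null (t := {a.toReal}) ?_ (measure_singleton _)
  rintro v ⟨hv, hv0, -⟩
  rw [Set.mem_ofPred_eq] at hv
  rw [Set.mem_singleton_iff, ← hv, ENNReal.toReal_ofReal hv0]

theorem unif_lt_ofReal_le {a : ℝ≥0∞} (ha : a ≤ 1) : unif {v | a < ENNReal.ofReal v} ≤ 1 - a := by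
  have ht : a ≠ ⊤ := ne_top_of_le_ne_top ENNReal.one_ne_top ha
  have hm : MeasurableSet {v : ℝ | a < ENNReal.ofReal v} :=
    measurableSet_lt measurable_const ENNReal.measurable_ofReal
  rw [unif, Measure.restrict_apply hm]
  calc volume ({v : ℝ | a < ENNReal.ofReal v} ∩ Set.Ico 0 1) ≤ volume (Set.Ico a.toReal 1) := by
        refine measure_mono ?_
        rintro v ⟨hv, hv0, hv1⟩
        exact ⟨(ENNReal.lt_ofReal_iff_toReal_lt ht).1 hv |>.le, hv1⟩
    _ = 1 - a := by
        rw [Real.volume_Ico, ENNReal.ofReal_sub _ ENNReal.toReal_nonneg, ENNReal.ofReal_one,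
          ENNReal.ofReal_toReal ht]

/-- The factor `E|θ̄[0]| + 1` in the rates is at least one, and the truncation at `α_{-1}` is
harmless because the levels `α_k^i` are at least `α_{-1}`. -/
theorem measure_alphaLen_lt_le [Nonempty A] [IsProbabilityMeasure μ]
    (hU0 : MeasurePreserving (U 0) μ unif) (k : ℕ) :
    μ {ω | alphaLen P τ (k + 1) (maxContext P τ (fun i => U i ω) (-1)) < ENNReal.ofReal (U 0 ω)}
      ≤ 1 - rate μ U P τ (k + 1) := by
  set q := μ {ω | alphaLen P τ (k + 1) (maxContext P τ (fun i => U i ω) (-1))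
    < ENNReal.ofReal (U 0 ω)} with hq
  have h1 : q ≤ 1 - alphaNeg P := by
    refine le_trans ?_ (unif_lt_ofReal_le (alphaNeg_le_one P))
    rw [← hU0.measure_preimage (measurableSet_lt measurable_const
      ENNReal.measurable_ofReal).nullMeasurableSet]
    exact measure_mono fun ω hω => (alphaNeg_le_alphaLen _ _).trans_lt hω
  have h2 : q ≤ 1 - (1 - (meanGood μ U P τ + 1) * q) := by
    calc q = 1 - (1 - q) := (ENNReal.sub_sub_cancel ENNReal.one_ne_top prob_le_one).symm
      _ ≤ 1 - (1 - (meanGood μ U P τ + 1) * q) := by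
        refine tsub_le_tsub_left (tsub_le_tsub_left ?_ _) _
        exact le_mul_of_one_le_left' le_add_self
  rw [rate]
  rcases le_total (1 - (meanGood μ U P τ + 1) * q) (alphaNeg P) with h | h
  · rw [sup_eq_right.2 h]; exact h1
  · rw [sup_eq_left.2 h]; exact h2

/-- The event that `U_0` needs a context that the last `m` values of `Y` do not determine. -/
def UnknownContext (P : Ker A) (τ : Set (Str A)) (m : ℕ) (u : ℤ → ℝ) : Prop :=
  ¬ ((spontaneous P (u 0)).isSome ∨ KnownContext P τ u (-m) m m)

theorem measurableSet_unknownContext (m : ℕ) :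
    MeasurableSet {u | UnknownContext P τ m u} :=
  ((measurableSet_isSome_spontaneous P 0).union (measurableSet_knownContext P τ _ _ _)).compl

theorem tsum_indicator_lt (W : ℕ∞) :
    ∑' m : ℕ, (if (m : ℕ∞) < W then 1 else 0 : ℝ≥0∞) ≤ (W : ℝ≥0∞) := by
  induction W using ENat.recTopCoe with
  | top => simp
  | coe n =>
    rw [tsum_eq_sum (s := Finset.range n)]
    · simp only [Nat.cast_lt]
      refine (Finset.sum_le_card_nsmul _ _ 1 fun i _ => by split_ifs <;> simp).trans ?_
      simp
    · intro i hi
      simp only [Finset.mem_range, not_lt] at hi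
      simp [hi]

theorem tsum_unknownContext_le (hτ : IsContextTree τ)
    (hU : MeasurePreserving (fun ω i => U i ω) μ seqLaw) :
    ∑' m : ℕ, seqLaw {u | UnknownContext P τ m u} ≤ meanGood μ U P τ := by
  have hm : ∀ m, MeasurableSet {ω | UnknownContext P τ m fun i => U i ω} := fun m =>
    hU.measurable (measurableSet_unknownContext m)
  calc ∑' m : ℕ, seqLaw {u | UnknownContext P τ m u}
      = ∑' m : ℕ, ∫⁻ ω, Set.indicator {ω | UnknownContext P τ m fun i => U i ω} 1 ω ∂μ := by
        refine tsum_congr fun m => ?_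
        rw [lintegral_indicator_one (hm m),
          ← hU.measure_preimage (measurableSet_unknownContext m).nullMeasurableSet]
        rfl
    _ = ∫⁻ ω, ∑' m : ℕ, Set.indicator {ω | UnknownContext P τ m fun i => U i ω} 1 ω ∂μ := by
        rw [lintegral_tsum]
        exact fun m => (measurable_one.indicator (hm m)).aemeasurable
    _ ≤ meanGood μ U P τ := by
        refine lintegral_mono fun ω => le_trans (ENNReal.tsum_le_tsum fun m => ?_)
          (tsum_indicator_lt (absGood P τ fun i => U i ω))
        by_cases h : UnknownContext P τ m fun i => U i ω
        · have hlt : (m : ℕ∞) < ((m + 1 : ℕ) : ℕ∞) := by exact_mod_cast Nat.lt_succ_self m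
          rw [if_pos (hlt.trans_le (lt_absGood hτ (u := fun i => U i ω) h))]
          exact Set.indicator_le_self' (fun _ _ => bot_le) ω
        · rw [Set.indicator_of_notMem (by exact h)]
          exact bot_le

/-- Half of the window is spent on the context and half on the local continuity. The extra term
accounts for the rate with index `0`, which is not a bound of this kind. -/
theorem seqLaw_unsafe_le [Nonempty A] [IsProbabilityMeasure μ] (hτ : IsContextTree τ)
    (hU : MeasurePreserving (fun ω i => U i ω) μ seqLaw) (n : ℕ) :
    seqLaw {u | ¬ Safe P τ u 0 n} ≤ seqLaw {u | UnknownContext P τ (n / 2) u} +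
      (1 - rate μ U P τ (n / 2)) + (if n / 2 = 0 then 1 else 0) := by
  rcases hk : n / 2 with _ | k
  · exact prob_le_one.trans (by simp)
  have hU0 : MeasurePreserving (U 0) μ unif :=
    (measurePreserving_eval_infinitePi (fun _ : ℤ => unif) 0).comp hU
  have hSm : ∀ t, MeasurableSet {u | ¬ Safe P τ u t n} :=
    fun t => (measurableSet_safe P τ t n).compl
  rw [← seqLaw_stationary (E := fun u t => ¬ Safe P τ u t n) (hSm 0)
      (fun h hu hs => hu (hs.congr fun i _ => (h i).symm)) (-n),
    ← hU.measure_preimage (hSm _).nullMeasurableSet,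
    ← hU.measure_preimage (measurableSet_unknownContext _).nullMeasurableSet]
  simp only [Nat.add_eq_zero_iff, one_ne_zero, and_false, if_false, add_zero]
  -- Safety asks for `U_0 < α_k^i`, the rate bounds `U_0 > α_k^i`; the ties form a null set.
  have hnull : μ {ω | ∃ i : ℕ∞, ENNReal.ofReal (U 0 ω) = alphaLen P τ (k + 1) i} = 0 := by
    rw [Set.ofPred_exists]
    refine measure_iUnion_null fun i => ?_
    exact hU0.quasiMeasurePreserving.preimage_null (unif_ofReal_eq _)
  refine le_trans ?_ (add_le_add_right (measure_alphaLen_lt_le hU0 k) _)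
  rw [← add_zero (μ {ω | alphaLen P τ (k + 1) _ < _}), ← hnull]
  refine (measure_mono ?_).trans ((measure_union_le _ _).trans
    (add_le_add_right (measure_union_le _ _) _))
  intro ω hω
  by_contra hcon
  simp only [Set.mem_union, not_or, Set.mem_preimage, Set.mem_ofPred_eq] at hcon
  obtain ⟨h1, h2, h3⟩ := hcon
  refine hω (safe_neg hτ (k := k + 1) (m := k + 1) (by omega) (not_not.1 h1) ?_)
  rw [not_lt] at h2
  exact lt_of_le_of_ne h2 fun h => h3 ⟨_, h⟩

theorem tsum_seqLaw_unsafe_ne_top [Nonempty A] [IsProbabilityMeasure μ] (hτ : IsContextTree τ)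
    (hU : MeasurePreserving (fun ω i => U i ω) μ seqLaw) (hgood : IsGood μ U P τ)
    (hreg : SummableRegime μ U P τ ∨ ExponentialRegime μ U P τ) :
    ∑' n : ℕ, seqLaw {u | ¬ Safe P τ u 0 n} ≠ ⊤ := by
  refine ne_top_of_le_ne_top ?_ (ENNReal.tsum_le_tsum fun n => seqLaw_unsafe_le hτ hU n)
  rw [tsum_half (fun m => seqLaw {u | UnknownContext P τ m u} + (1 - rate μ U P τ m) +
    (if m = 0 then 1 else 0)), ENNReal.tsum_add, ENNReal.tsum_add, tsum_ite_eq]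
  have h1 : ∑' m : ℕ, seqLaw {u | UnknownContext P τ m u} ≠ ⊤ :=
    ne_top_of_le_ne_top hgood.ne (tsum_unknownContext_le hτ hU)
  have h2 : ∑' m : ℕ, (1 - rate μ U P τ m) ≠ ⊤ := by
    rcases hreg with h | h
    · exact h.ne
    · exact h.2.tsum_ne_top
  have h3 := ENNReal.add_ne_top.2 ⟨ENNReal.add_ne_top.2 ⟨h1, h2⟩, ENNReal.one_ne_top⟩
  exact ENNReal.add_ne_top.2 ⟨h3, h3⟩

theorem expDecay_seqLaw_unsafe [Nonempty A] [IsProbabilityMeasure μ] (hτ : IsContextTree τ)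
    (hU : MeasurePreserving (fun ω i => U i ω) μ seqLaw) (hreg : ExponentialRegime μ U P τ) :
    ExpDecay fun n => seqLaw {u | ¬ Safe P τ u 0 n} := by
  have h1 : ExpDecay fun m => seqLaw {u | UnknownContext P τ m u} := by
    refine hreg.1.mono fun m => ?_
    rw [← hU.measure_preimage (measurableSet_unknownContext m).nullMeasurableSet]
    refine measure_mono fun ω hω => le_trans ?_ (lt_absGood hτ (u := fun i => U i ω) hω)
    exact_mod_cast Nat.le_succ m
  have h2 : ExpDecay fun m : ℕ => if m = 0 then 1 else 0 := by
    refine ⟨1, 1 / 2, one_pos, by norm_num, by norm_num, fun m => ?_⟩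
    rcases eq_or_ne m 0 with rfl | h
    · simp
    · simp [h]
  exact ((h1.add hreg.2).add h2).half.mono (seqLaw_unsafe_le hτ hU)

end Rates

/-! ### The renewal structure -/

/-- A set of integers that is unbounded in both directions is enumerated in increasing order by the
integers, in such a way that `0` has its place between the elements of index `0` and `1`. -/
theorem exists_enumeration {R : ℤ → Prop} (hge : ∀ t, ∃ s ≥ t, R s) (hlt : ∀ t, ∃ s < t, R s) :
    ∃ T : ℤ → ℤ, StrictMono T ∧ (∀ t, R t ↔ ∃ l, T l = t) ∧ T 0 ≤ 0 ∧ 0 < T 1 := by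
  classical
  obtain ⟨t₀, ⟨ht₀, hR₀⟩, hmax⟩ : ∃ t, (t ≤ 0 ∧ R t) ∧ ∀ s, s ≤ 0 ∧ R s → s ≤ t := by
    obtain ⟨s, hs, hRs⟩ := hlt 0
    obtain ⟨t, h1, h2⟩ := Int.exists_greatest_of_bdd (P := fun s => s ≤ 0 ∧ R s)
      ⟨0, fun s h => h.1⟩ ⟨s, hs.le, hRs⟩
    exact ⟨t, h1, h2⟩
  let ι := {t : ℤ // R t}
  have : Nonempty ι := ⟨⟨t₀, hR₀⟩⟩
  have : NoMaxOrder ι := ⟨fun a => by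
    obtain ⟨s, hs, hRs⟩ := hge (a.1 + 1)
    exact ⟨⟨s, hRs⟩, Subtype.mk_lt_mk.2 (by omega)⟩⟩
  have : NoMinOrder ι := ⟨fun a => by
    obtain ⟨s, hs, hRs⟩ := hlt a.1
    exact ⟨⟨s, hRs⟩, Subtype.mk_lt_mk.2 hs⟩⟩
  let _ : SuccOrder ι := LinearLocallyFiniteOrder.succOrder ι
  let _ : PredOrder ι := LinearLocallyFiniteOrder.predOrder ι
  let e : ι ≃o ℤ := orderIsoIntOfLinearSuccPredArch
  have hmono : StrictMono fun l : ℤ => (e.symm (l + e ⟨t₀, hR₀⟩)).1 := by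
    intro l l' h
    exact e.symm.strictMono (add_lt_add_left h _)
  have h0 : (e.symm (0 + e ⟨t₀, hR₀⟩)).1 = t₀ := by simp
  refine ⟨fun l => (e.symm (l + e ⟨t₀, hR₀⟩)).1, hmono, fun t => ⟨fun h => ?_, ?_⟩, ?_, ?_⟩
  · exact ⟨e ⟨t, h⟩ - e ⟨t₀, hR₀⟩, by simp⟩
  · rintro ⟨l, rfl⟩
    exact (e.symm (l + e ⟨t₀, hR₀⟩)).2
  · simp only [h0]; exact ht₀
  · by_contra hcon
    have h1 := hmax _ ⟨not_lt.1 hcon, (e.symm (1 + e ⟨t₀, hR₀⟩)).2⟩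
    have h2 := hmono (zero_lt_one (α := ℤ))
    simp only [h0] at h2
    exact absurd h1 (not_le.2 h2)

instance {A : Type*} : DiscreteMeasurableSpace (List A) := ⟨fun _ => trivial⟩

section Renewal

variable {A : Type*} [Encodable A] [Nonempty A] (P : Ker A)

/-- The probability that a given time is a regeneration time. -/
noncomputable def regenProb : ℝ≥0∞ := seqLaw {u | IsRegenTime (update P) u 0}

/-- The conditional probability that the string started at a regeneration time is `w`. -/
noncomputable def cycleProb (w : List A) : ℝ≥0∞ := seqLaw {u | IsCycle (update P) u 0 w}

/-- `T` enumerates the regeneration times of almost every sequence. Strict monotonicity is asked of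
every sequence, so that the lengths of the strings are the increments everywhere. -/
def Enumerates (T : (ℤ → ℝ) → ℤ → ℤ) : Prop :=
  (∀ u, StrictMono (T u)) ∧ ∀ᵐ u ∂seqLaw,
    (∀ t, IsRegenTime (update P) u t ↔ ∃ l, T u l = t) ∧ T u 0 ≤ 0 ∧ 0 < T u 1

/-- The string between the regeneration times of index `i` and `i + 1`. -/
noncomputable def cycleString (T : (ℤ → ℝ) → ℤ → ℤ) (i : ℤ) (u : ℤ → ℝ) : List A :=
  stringBetween (reconstruct (update P) u) (T u i) (T u (i + 1))

theorem exists_enumerates (hge : ∀ t, ∀ᵐ u ∂seqLaw, ∃ s ≥ t, IsRegenTime (update P) u s)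
    (hlt : ∀ t, ∀ᵐ u ∂seqLaw, ∃ s < t, IsRegenTime (update P) u s) :
    ∃ T, Enumerates P T := by
  classical
  have h : ∀ u : ℤ → ℝ, ∃ T : ℤ → ℤ, StrictMono T ∧
      (((∀ t, ∃ s ≥ t, IsRegenTime (update P) u s) ∧ ∀ t, ∃ s < t, IsRegenTime (update P) u s) →
        (∀ t, IsRegenTime (update P) u t ↔ ∃ l, T l = t) ∧ T 0 ≤ 0 ∧ 0 < T 1) := by
    intro u
    by_cases hu : (∀ t, ∃ s ≥ t, IsRegenTime (update P) u s) ∧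
        ∀ t, ∃ s < t, IsRegenTime (update P) u s
    · obtain ⟨T, h1, h2⟩ := exists_enumeration hu.1 hu.2
      exact ⟨T, h1, fun _ => h2⟩
    · exact ⟨id, strictMono_id, fun h => absurd h hu⟩
  choose T hT hT' using h
  refine ⟨T, hT, ?_⟩
  filter_upwards [ae_all_iff.2 hge, ae_all_iff.2 hlt] with u h1 h2
  exact hT' u ⟨h1, h2⟩

theorem seqLaw_startsWith (ws : List (List A)) (t : ℤ) :
    seqLaw {u | StartsWith (update P) u ws t} = (ws.map (cycleProb P)).prod * regenProb P := by
  induction ws generalizing t with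
  | nil =>
    simp only [StartsWith, List.map_nil, List.prod_nil, one_mul, regenProb]
    exact seqLaw_stationary (measurableSet_isRegenTime P 0) IsRegenTime.congr t
  | cons w ws ih =>
    have : {u | StartsWith (update P) u (w :: ws) t} = {u | IsCycle (update P) u t w} ∩
      {u | StartsWith (update P) u ws (t + w.length)} := rfl
    rw [this, seqLaw_inter_eq_mul (t + w.length) (measurableSet_isCycle P t w)
      (measurableSet_startsWith P ws _)
      (fun u u' h hu => IsCycle.congr (fun i hi => h _ (by omega)) hu)
      (fun u u' h hu => StartsWith.congr (fun i => h _ (by omega)) hu), ih,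
      seqLaw_stationary (E := fun u t => IsCycle (update P) u t w) (measurableSet_isCycle P 0 w)
        (fun h hu => hu.congr fun i _ => h i)]
    simp only [List.map_cons, List.prod_cons, mul_assoc, cycleProb]

variable {P} {T : (ℤ → ℝ) → ℤ → ℤ}

theorem Enumerates.length_cycleString (hT : Enumerates P T) (i : ℤ) (u : ℤ → ℝ) :
    ((cycleString P T i u).length : ℤ) = T u (i + 1) - T u i := by
  have := hT.1 u (lt_add_one i)
  simp only [cycleString, stringBetween, List.length_ofFn]
  omega

theorem Enumerates.apply_add (hT : Enumerates P T) {W : ℕ → List A} {l : ℤ} {n : ℕ} {u : ℤ → ℝ}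
    (h : ∀ j < n, cycleString P T (l + j) u = W j) :
    T u (l + n) = T u l + ∑ j ∈ Finset.range n, ((W j).length : ℤ) := by
  induction n with
  | zero => simp
  | succ n ih =>
    rw [Finset.sum_range_succ, ← add_assoc, ← ih fun j hj => h j (hj.trans (Nat.lt_succ_self n)),
      ← h n (Nat.lt_succ_self n), hT.length_cycleString]
    push_cast
    rw [add_assoc l]
    ring

theorem Enumerates.startsWith_ofFn_iff (hT : Enumerates P T) {u : ℤ → ℝ}
    (hR : ∀ t, IsRegenTime (update P) u t ↔ ∃ l, T u l = t) (W : ℕ → List A) (n : ℕ) (l : ℤ) :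
    StartsWith (update P) u (List.ofFn fun j : Fin n => W j) (T u l) ↔
      ∀ j < n, cycleString P T (l + j) u = W j := by
  rw [startsWith_iff hR (hT.1 u)]
  simp only [List.length_ofFn, List.getElem_ofFn, cycleString]

/-- Fixing the strings of indices `-m, …, m` leaves open only the place of the time `0` inside the
string of index `0`. -/
theorem Enumerates.ae_cycleString_iff (hT : Enumerates P T) (m : ℕ) (W : ℕ → List A) :
    ∀ᵐ u ∂seqLaw, (∀ j < 2 * m + 1, cycleString P T (-m + j) u = W j) ↔
      ∃ k < (W m).length, StartsWith (update P) u (List.ofFn fun j : Fin (2 * m + 1) => W j)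
        (-k - ∑ j ∈ Finset.range m, ((W j).length : ℤ)) := by
  filter_upwards [hT.2] with u hu
  obtain ⟨hR, h0, h1⟩ := hu
  have hmono := hT.1 u
  have hst := hT.startsWith_ofFn_iff hR W (2 * m + 1)
  have hpos : ∀ l, (∀ j < 2 * m + 1, cycleString P T (l + j) u = W j) →
      T u (l + m) = T u l + ∑ j ∈ Finset.range m, ((W j).length : ℤ) ∧
      T u (l + m + 1) = T u (l + m) + (W m).length := by
    intro l h
    refine ⟨hT.apply_add fun j hj => h j (by omega), ?_⟩
    rw [← h m (by omega), hT.length_cycleString]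
    ring
  constructor
  · intro h
    obtain ⟨h2, h3⟩ := hpos _ h
    rw [neg_add_cancel] at h2 h3
    rw [zero_add] at h3
    refine ⟨(-T u 0).toNat, by omega, ?_⟩
    convert (hst (-m)).2 h using 1
    omega
  · rintro ⟨k, hk, h⟩
    obtain ⟨l, hl⟩ := (hR _).1 h.isRegenTime
    rw [← hl, hst] at h
    obtain ⟨h2, h3⟩ := hpos _ h
    have h4 : l + m < 1 := hmono.lt_iff_lt.1 (by omega)
    have h5 : 0 < l + m + 1 := hmono.lt_iff_lt.1 (by omega)
    obtain rfl : l = -m := by omega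
    exact h

theorem Enumerates.nullMeasurableSet_cycleString (hT : Enumerates P T) (m : ℕ) (W : ℕ → List A) :
    NullMeasurableSet {u | ∀ j < 2 * m + 1, cycleString P T (-m + j) u = W j} seqLaw := by
  have : MeasurableSet {u | ∃ k < (W m).length,
      StartsWith (update P) u (List.ofFn fun j : Fin (2 * m + 1) => W j)
        (-k - ∑ j ∈ Finset.range m, ((W j).length : ℤ))} := by
    simp only [Set.ofPred_exists, Set.ofPred_and]
    exact MeasurableSet.iUnion fun k => (MeasurableSet.const _).inter
      (measurableSet_startsWith P _ _)
  exact this.nullMeasurableSet.congr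
    (Filter.EventuallyEq.symm (eventuallyEq_set.2 (hT.ae_cycleString_iff m W)))

theorem Enumerates.seqLaw_cycleString (hT : Enumerates P T) (m : ℕ) (W : ℕ → List A) :
    seqLaw {u | ∀ j < 2 * m + 1, cycleString P T (-m + j) u = W j} =
      (W m).length * ((∏ j : Fin (2 * m + 1), cycleProb P (W j)) * regenProb P) := by
  set L : ℤ := ∑ j ∈ Finset.range m, ((W j).length : ℤ) with hL
  set E : ℕ → Set (ℤ → ℝ) := fun k =>
    {u | StartsWith (update P) u (List.ofFn fun j : Fin (2 * m + 1) => W j) (-k - L)} with hE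
  have h1 : seqLaw {u | ∀ j < 2 * m + 1, cycleString P T (-m + j) u = W j} =
      seqLaw (⋃ k ∈ Finset.range (W m).length, E k) := by
    refine measure_congr (eventuallyEq_set.2 ?_)
    filter_upwards [hT.ae_cycleString_iff m W] with u hu
    refine hu.trans ?_
    simp [hE, hL]
  have hdisj : Set.Pairwise (Finset.range (W m).length : Set ℕ)
      (Function.onFun (AEDisjoint seqLaw) E) := by
    intro k hk k' hk' hne
    have hae : ∀ᵐ u ∂seqLaw, ¬ (u ∈ E k ∩ E k') := by
      filter_upwards [hT.2, hT.ae_cycleString_iff m W] with u hu hiff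
      rintro ⟨h, h'⟩
      obtain ⟨hR, h7, h8⟩ := hu
      have hc := hiff.2 ⟨k, by simpa using hk, h⟩
      have key : ∀ k : ℕ, k < (W m).length → u ∈ E k → T u 0 = -k := by
        intro k hk h
        have h2 := hT.apply_add (l := -m) (n := m) fun j hj => hc j (by omega)
        have h3 := hT.apply_add (l := -m) (n := m + 1) fun j hj => hc j (by omega)
        rw [Finset.sum_range_succ] at h3
        obtain ⟨l, hl⟩ := (hR _).1 h.isRegenTime
        have h4' : ∀ j < 2 * m + 1, cycleString P T (l + j) u = W j := by
          rw [← hT.startsWith_ofFn_iff hR, hl]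
          exact h
        have h5 := hT.apply_add (l := l) (n := m) fun j hj => h4' j (by omega)
        have h6 := hT.apply_add (l := l) (n := m + 1) fun j hj => h4' j (by omega)
        rw [Finset.sum_range_succ] at h6
        have h9 : l + m < 1 := (hT.1 u).lt_iff_lt.1 (by omega)
        have h10 : 0 < l + (m + 1 : ℕ) := (hT.1 u).lt_iff_lt.1 (by omega)
        have h11 : l + m = 0 := by push_cast at h10; omega
        rw [h11] at h5
        omega
      have e1 := key k (by simpa using hk) h
      have e2 := key k' (by simpa using hk') h'
      omega
    exact measure_eq_zero_iff_ae_notMem.2 hae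
  rw [h1, measure_biUnion_finset₀ hdisj
    fun k _ => (measurableSet_startsWith P _ _).nullMeasurableSet]
  simp only [hE, seqLaw_startsWith, Finset.sum_const, Finset.card_range, nsmul_eq_mul,
    List.map_ofFn, List.prod_ofFn, Function.comp_apply]

theorem Enumerates.aemeasurable_cycleString (hT : Enumerates P T) (i : ℤ) :
    AEMeasurable (cycleString P T i) seqLaw := by
  refine NullMeasurable.aemeasurable fun s _ => ?_
  have hn : (-(i.natAbs : ℤ)) + ((i + i.natAbs).toNat : ℤ) = i := by omega
  have : cycleString P T i ⁻¹' s = ⋃ w : {w : Fin (2 * i.natAbs + 1) → List A //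
      w ⟨(i + i.natAbs).toNat, by omega⟩ ∈ s},
      {u | ∀ j < 2 * i.natAbs + 1, cycleString P T (-(i.natAbs : ℤ) + j) u =
        (fun j : ℕ => if h : j < 2 * i.natAbs + 1 then w.1 ⟨j, h⟩ else []) j} := by
    ext u
    simp only [Set.mem_preimage, Set.mem_iUnion, Set.mem_ofPred_eq]
    constructor
    · intro hu
      refine ⟨⟨fun j => cycleString P T (-(i.natAbs : ℤ) + (j : ℕ)) u, ?_⟩, fun j hj => ?_⟩
      · simpa only [hn] using hu
      · simp [hj]
    · rintro ⟨⟨w, hw⟩, hu⟩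
      have := hu (i + i.natAbs).toNat (by omega)
      rw [hn, dif_pos (by omega)] at this
      rw [this]
      exact hw
  rw [this]
  exact NullMeasurableSet.iUnion fun w => hT.nullMeasurableSet_cycleString _ _

theorem startsWith_singleton_unique {u : ℤ → ℝ} {t : ℤ} {w w' : List A}
    (h : StartsWith (update P) u [w] t) (h' : StartsWith (update P) u [w'] t) : w = w' := by
  have key : ∀ {w w' : List A}, StartsWith (update P) u [w] t → StartsWith (update P) u [w'] t →
      ¬ w.length < w'.length := fun {w w'} h h' hlt =>
    ((isCycle_iff h'.2).1 h'.1).2.2 w.length (List.length_pos_iff.2 h.1.1) hlt h.2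
  have hlen := le_antisymm (not_lt.1 (key h' h)) (not_lt.1 (key h h'))
  exact List.reverse_injective (h.1.2.1.eq h'.1.2.1 (by simpa using hlen))

theorem pairwise_disjoint_startsWith (t : ℤ) :
    Pairwise (Function.onFun Disjoint fun w => {u | StartsWith (update P) u [w] t}) := by
  intro w w' hne
  rw [Function.onFun, Set.disjoint_left]
  exact fun u h h' => hne (startsWith_singleton_unique h h')

theorem regenProb_ne_top : regenProb P ≠ ⊤ := measure_ne_top _ _

theorem Enumerates.tsum_cycleProb (hT : Enumerates P T) (hp : regenProb P ≠ 0) :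
    ∑' w, cycleProb P w = 1 := by
  have h1 : ∑' w, cycleProb P w * regenProb P = regenProb P := by
    have : ∀ w, cycleProb P w * regenProb P = seqLaw {u | StartsWith (update P) u [w] 0} :=
      fun w => by rw [seqLaw_startsWith]; simp
    simp only [this]
    rw [← measure_iUnion (pairwise_disjoint_startsWith 0)
      fun w => measurableSet_startsWith P [w] 0, regenProb]
    refine measure_congr (eventuallyEq_set.2 ?_)
    filter_upwards [hT.2] with u hu
    simp only [Set.mem_iUnion, Set.mem_ofPred_eq]
    refine ⟨fun ⟨w, hw⟩ => hw.isRegenTime, fun h => ?_⟩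
    obtain ⟨l, hl⟩ := (hu.1 0).1 h
    refine ⟨cycleString P T l u, ?_⟩
    rw [← hl, startsWith_iff hu.1 (hT.1 u)]
    intro j hj
    obtain rfl : j = 0 := by simpa using hj
    simp [cycleString]
  rw [ENNReal.tsum_mul_right] at h1
  exact (ENNReal.mul_eq_right hp regenProb_ne_top).1 h1

/-- The mass function of the string of index `i`: the strings with index other than `0` are
distributed like the string that starts at a typical regeneration time, while the one that contains
the time `0` is size-biased. -/
noncomputable def cycleMass (P : Ker A) (i : ℤ) (w : List A) : ℝ≥0∞ :=
  cycleProb P w * if i = 0 then w.length * regenProb P else 1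

theorem Enumerates.seqLaw_cycleString_eq (hT : Enumerates P T) (m : ℕ)
    (w : Fin (2 * m + 1) → List A) :
    seqLaw {u | ∀ j : Fin (2 * m + 1), cycleString P T (-m + (j : ℕ)) u = w j} =
      ∏ j : Fin (2 * m + 1), cycleMass P (-m + (j : ℕ)) (w j) := by
  have h := hT.seqLaw_cycleString m
    fun j : ℕ => if h : j < 2 * m + 1 then w ⟨j, h⟩ else []
  have hset : {u | ∀ j : Fin (2 * m + 1), cycleString P T (-m + (j : ℕ)) u = w j} =
      {u | ∀ j < 2 * m + 1, cycleString P T (-m + j) u =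
        (fun j : ℕ => if h : j < 2 * m + 1 then w ⟨j, h⟩ else []) j} := by
    ext u
    refine ⟨fun hu j hj => ?_, fun hu j => ?_⟩
    · simpa [hj] using hu ⟨j, hj⟩
    · exact (hu j j.2).trans (dif_pos j.2)
  rw [hset, h]
  simp only [cycleMass, Finset.prod_mul_distrib, Fin.is_lt, dite_true, Fin.eta]
  have hm : m < 2 * m + 1 := by omega
  have hprod : ∏ j : Fin (2 * m + 1),
      (if -(m : ℤ) + (j : ℕ) = 0 then ((w j).length : ℝ≥0∞) * regenProb P else 1) =
      (w ⟨m, hm⟩).length * regenProb P := by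
    rw [Finset.prod_eq_single ⟨m, hm⟩]
    · simp
    · intro j _ hj
      rw [if_neg]
      intro h0
      exact hj (Fin.ext (by simpa using (by omega : (j : ℕ) = m)))
    · simp
  rw [hprod, dif_pos hm]
  ring

theorem Enumerates.tsum_cycleMass (hT : Enumerates P T) (hp : regenProb P ≠ 0) (i : ℤ) :
    ∑' w, cycleMass P i w = 1 := by
  by_cases hi : i = 0
  · subst hi
    have h : ∀ w, cycleMass P 0 w = seqLaw.map (cycleString P T 0) {w} := by
      intro w
      rw [Measure.map_apply_of_aemeasurable (hT.aemeasurable_cycleString 0)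
        (measurableSet_singleton w)]
      have := hT.seqLaw_cycleString_eq 0 fun _ => w
      refine Eq.trans ?_ (this.symm.trans (congrArg seqLaw ?_))
      · simp
      · ext u; simp
    simp only [h]
    have := Measure.isProbabilityMeasure_map (hT.aemeasurable_cycleString 0)
    have h2 := lintegral_countable' (μ := seqLaw.map (cycleString P T 0)) fun _ => 1
    simpa using h2.symm
  · simp only [cycleMass, hi, if_false, mul_one]
    exact hT.tsum_cycleProb hp

/-- The law of the string of index `i`. -/
noncomputable def Enumerates.cycleLaw (hT : Enumerates P T) (hp : regenProb P ≠ 0) (i : ℤ) :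
    PMF (List A) :=
  ⟨cycleMass P i, ENNReal.summable.hasSum_iff.2 (hT.tsum_cycleMass hp i)⟩

theorem Enumerates.hasLaw_pi (hT : Enumerates P T) (hp : regenProb P ≠ 0) (m : ℕ) :
    HasLaw (fun u (j : Fin (2 * m + 1)) => cycleString P T (-m + (j : ℕ)) u)
      (Measure.pi fun j : Fin (2 * m + 1) => (hT.cycleLaw hp (-m + (j : ℕ))).toMeasure) seqLaw := by
  have hae : AEMeasurable (fun u (j : Fin (2 * m + 1)) => cycleString P T (-m + (j : ℕ)) u)
      seqLaw := aemeasurable_pi_lambda _ fun j => hT.aemeasurable_cycleString _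
  refine ⟨hae, Measure.ext_of_singleton fun w => ?_⟩
  rw [Measure.map_apply_of_aemeasurable hae (measurableSet_singleton w), Measure.pi_singleton]
  simp only [PMF.toMeasure_apply_singleton _ _ (measurableSet_singleton _)]
  refine Eq.trans ?_ (hT.seqLaw_cycleString_eq m w)
  congr 1
  ext u
  simp [funext_iff]

theorem Enumerates.hasLaw (hT : Enumerates P T) (hp : regenProb P ≠ 0) (i : ℤ) :
    HasLaw (cycleString P T i) (hT.cycleLaw hp i).toMeasure seqLaw := by
  have hn : (-(i.natAbs : ℤ)) + ((i + i.natAbs).toNat : ℤ) = i := by omega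
  have h := (measurePreserving_eval (fun j : Fin (2 * i.natAbs + 1) =>
    (hT.cycleLaw hp (-(i.natAbs : ℤ) + (j : ℕ))).toMeasure)
    ⟨(i + i.natAbs).toNat, by omega⟩).hasLaw.comp (hT.hasLaw_pi hp i.natAbs)
  simp only [hn] at h
  convert h using 1
  funext u
  simp only [Function.eval, Function.comp_apply, hn]

theorem Enumerates.iIndepFun (hT : Enumerates P T) (hp : regenProb P ≠ 0) {Ω : Type*}
    [MeasurableSpace Ω] {μ : Measure Ω} [IsProbabilityMeasure μ] {X : Ω → ℤ → ℝ}
    (hX : HasLaw X seqLaw μ) :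
    iIndepFun (fun (i : ℤ) ω => cycleString P T i (X ω)) μ := by
  rw [iIndepFun_iff_finset]
  intro s
  set m := s.sup Int.natAbs with hm
  have hle : ∀ i ∈ s, i.natAbs ≤ m := fun i hi => Finset.le_sup hi
  have h1 := (iIndepFun_iff_hasLaw_pi_pi
    (fun j : Fin (2 * m + 1) => (hT.hasLaw hp (-m + (j : ℕ))).comp hX)).2
    ((hT.hasLaw_pi hp m).comp hX)
  have hlt : ∀ i : s, (i.1 + m).toNat < 2 * m + 1 := fun i => by have := hle i.1 i.2; omega
  have hg : Function.Injective fun i : s => (⟨(i.1 + m).toNat, hlt i⟩ : Fin (2 * m + 1)) := by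
    intro i i' h
    have h1 := hle i.1 i.2
    have h2 := hle i'.1 i'.2
    simp only [Fin.mk.injEq] at h
    exact Subtype.ext (by omega)
  have h2 := h1.precomp hg
  convert h2 using 2 with i
  have : -(m : ℤ) + ((i.1 + m).toNat : ℤ) = i.1 := by have := hle i.1 i.2; omega
  funext ω
  simp only [Finset.restrict, Function.comp_apply, this]

end Renewal

/-! ### The length of a string -/

section Length

variable {A : Type*} [Encodable A] [Nonempty A] {P : Ker A} {T : (ℤ → ℝ) → ℤ → ℤ}

/-- The size-biased masses of the string that contains the time `0` sum up to one. -/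
theorem Enumerates.tsum_length_mul_cycleProb_ne_top (hT : Enumerates P T) (hp : regenProb P ≠ 0) :
    ∑' w, (w.length : ℝ≥0∞) * cycleProb P w ≠ ⊤ := by
  have h := hT.tsum_cycleMass hp 0
  have h1 : ∀ w, cycleMass P 0 w = (w.length : ℝ≥0∞) * cycleProb P w * regenProb P := by
    intro w; simp only [cycleMass, if_true]; ring
  simp only [h1] at h
  rw [ENNReal.tsum_mul_right] at h
  intro htop
  rw [htop, ENNReal.top_mul hp] at h
  exact ENNReal.top_ne_one h

/-- A string of length at least `n` that starts at time `0` leaves no regeneration time among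
`1, …, n - 1`. -/
theorem tsum_cycleProb_length_ge_le {τ : Set (Str A)} (hτ : IsContextTree τ)
    (hp : regenProb P ≠ 0) (n : ℕ) :
    ∑' w, (if n ≤ w.length then cycleProb P w else 0) ≤
      (regenProb P)⁻¹ * seqLaw {u | NoAlwaysSafe P τ (n - 1 : ℕ) u 0} := by
  rw [← ENNReal.div_eq_inv_mul, ENNReal.le_div_iff_mul_le (Or.inl hp) (Or.inl regenProb_ne_top),
    ← ENNReal.tsum_mul_right,
    ← seqLaw_stationary (measurableSet_noAlwaysSafe P τ _ 0) NoAlwaysSafe.congr 1]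
  have h1 : ∀ w : List A, (if n ≤ w.length then cycleProb P w else 0) * regenProb P =
      seqLaw {u | n ≤ w.length ∧ StartsWith (update P) u [w] 0} := by
    intro w
    split_ifs with h
    · simp [h, seqLaw_startsWith]
    · simp [h]
  simp only [h1]
  rw [← measure_iUnion]
  · refine measure_mono fun u hu s hs hA => ?_
    obtain ⟨w, hn, hw⟩ := Set.mem_iUnion.1 hu
    have hs' : s < n - 1 := by exact_mod_cast hs
    have h2 := ((isCycle_iff hw.2).1 hw.1).2.2 (s + 1) (Nat.succ_pos s) (by omega)
    refine h2 ?_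
    have h3 := isRegenTime_of_safe hτ hA
    convert h3 using 1
    push_cast; ring
  · intro w w' hne
    rw [Function.onFun, Set.disjoint_left]
    exact fun u h h' => hne (startsWith_singleton_unique h.2 h'.2)
  · exact fun w => (MeasurableSet.const _).inter (measurableSet_startsWith P [w] 0)

theorem ExpDecay.pred {c : ℕ → ℝ≥0∞} (h : ExpDecay c) : ExpDecay fun n => c (n - 1) := by
  obtain ⟨D, d, hD, hd0, hd1, hc⟩ := h
  refine ⟨D / d, d, by positivity, hd0, hd1, fun n => (hc (n - 1)).trans
    (ENNReal.ofReal_le_ofReal ?_)⟩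
  have h1 : d ^ (n - 1) * d ≤ d ^ n := by
    rw [← pow_succ]
    exact pow_le_pow_of_le_one hd0.le hd1.le (by omega)
  rw [div_mul_eq_mul_div, le_div_iff₀ hd0, mul_assoc]
  gcongr

end Length

end PerfectSimulation

theorem corollary2 {A : Type*} [Encodable A] [Nonempty A]
    {Ω : Type*} [MeasurableSpace Ω] (μ : Measure Ω) [IsProbabilityMeasure μ]
    (U : ℤ → Ω → ℝ) (hUmeas : ∀ i, Measurable (U i)) (hUindep : iIndepFun U μ)
    (hUunif : ∀ i, μ.map (U i) = volume.restrict (Set.Ico (0 : ℝ) 1))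
    (P : Ker A) (τ : Set (Str A)) (hτ : IsSkeleton τ) (hLC : LocallyContinuous P τ)
    (hnull : WeaklyNonNull P) (hgood : IsGood μ U P τ)
    (hreg : SummableRegime μ U P τ ∨ ExponentialRegime μ U P τ) :
    ∃ T : ℤ → Ω → ℤ,
      EnumeratesRegenTimes μ U (update P) T ∧
      IsRenewal μ T ∧
      iIndepFun (fun (i : {i : ℤ // i ≠ 0}) (ω : Ω) => regenString U (update P) T i ω) μ ∧
      (∀ i j : ℤ, i ≠ 0 → j ≠ 0 →
        IdentDistrib (regenString U (update P) T i) (regenString U (update P) T j) μ μ) ∧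
      (∀ i : ℤ, i ≠ 0 → ∫⁻ ω, ((regenString U (update P) T i ω).length : ℝ≥0∞) ∂μ < ⊤) ∧
      (ExponentialRegime μ U P τ → ∀ i : ℤ, i ≠ 0 →
        ExpDecay fun n => μ {ω | n ≤ (regenString U (update P) T i ω).length}) := by
  have hC := hτ.isContextTree
  have hU := map_eq_seqLaw hUmeas hUindep hUunif
  have hpos := seqLaw_alwaysSafe_pos hnull (tsum_seqLaw_unsafe_ne_top hC hU hgood hreg)
  have hp : regenProb P ≠ 0 :=
    (hpos.trans_le (measure_mono fun u hu => isRegenTime_of_safe hC hu)).ne'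
  obtain ⟨T, hT⟩ := exists_enumerates P
    (fun t => (ae_exists_alwaysSafe_ge hpos t).mono fun u ⟨s, hs, hA⟩ =>
      ⟨s, hs, isRegenTime_of_safe hC hA⟩)
    (fun t => (ae_exists_alwaysSafe_lt hpos t).mono fun u ⟨s, hs, hA⟩ =>
      ⟨s, hs, isRegenTime_of_safe hC hA⟩)
  have hX : HasLaw (fun ω i => U i ω) seqLaw μ := hU.hasLaw
  have hlaw : ∀ i : ℤ, HasLaw (regenString U (update P) (fun l ω => T (fun i => U i ω) l) i)
      (hT.cycleLaw hp i).toMeasure μ := fun i => (hT.hasLaw hp i).comp hX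
  have hmass : ∀ i : ℤ, i ≠ 0 → ∀ w, (hT.cycleLaw hp i).toMeasure {w} = cycleProb P w := by
    intro i hi w
    rw [PMF.toMeasure_apply_singleton _ _ (measurableSet_singleton _)]
    change cycleMass P i w = _
    simp [cycleMass, hi]
  have hident : ∀ i j : ℤ, i ≠ 0 → j ≠ 0 →
      IdentDistrib (regenString U (update P) (fun l ω => T (fun i => U i ω) l) i)
        (regenString U (update P) (fun l ω => T (fun i => U i ω) l) j) μ μ := by
    intro i j hi hj
    refine ⟨(hlaw i).aemeasurable, (hlaw j).aemeasurable, ?_⟩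
    rw [(hlaw i).map_eq, (hlaw j).map_eq]
    exact Measure.ext_of_singleton fun w => by rw [hmass i hi, hmass j hj]
  have hindep : iIndepFun (fun (i : ℤ) (ω : Ω) =>
      regenString U (update P) (fun l ω => T (fun i => U i ω) l) i ω) μ := hT.iIndepFun hp hX
  have hlen : ∀ (i : ℤ) (ω : Ω), ((regenString U (update P)
      (fun l ω => T (fun i => U i ω) l) i ω).length : ℤ) =
      T (fun i => U i ω) (i + 1) - T (fun i => U i ω) i :=
    fun i ω => hT.length_cycleString i fun i => U i ω
  refine ⟨fun l ω => T (fun i => U i ω) l, ?_, ⟨?_, ?_⟩, ?_, hident, ?_, ?_⟩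
  · filter_upwards [hU.quasiMeasurePreserving.ae hT.2] with ω hω
    exact ⟨hω.1, fun l => hT.1 _ (lt_add_one l), hω.2⟩
  · have h := hindep.comp (fun _ w => (w.length : ℤ)) fun _ => measurable_from_top
    simpa only [Function.comp_def, hlen] using h
  · intro i j hi hj
    have h := (hident i j hi hj).comp (u := fun w => (w.length : ℤ)) measurable_from_top
    simpa only [Function.comp_def, hlen] using h
  · exact hindep.precomp Subtype.val_injective
  · intro i hi
    rw [← lintegral_map' (f := fun w : List A => (w.length : ℝ≥0∞))
      measurable_from_top.aemeasurable (hlaw i).aemeasurable, (hlaw i).map_eq,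
      lintegral_countable']
    simp only [hmass i hi]
    exact (hT.tsum_length_mul_cycleProb_ne_top hp).lt_top
  · intro hexp i hi
    have h1 := (expDecay_noAlwaysSafe hpos (expDecay_seqLaw_unsafe hC hU hexp)).pred.const_mul
      (ENNReal.inv_ne_top.2 hp)
    refine h1.mono fun n => le_trans (le_of_eq ?_) (tsum_cycleProb_length_ge_le hC hp n)
    rw [(hlaw i).measure_eq (p := fun w => n ≤ w.length) trivial,
      ← lintegral_indicator_one (μ := (hT.cycleLaw hp i).toMeasure) (s := {w | n ≤ w.length})
        trivial, lintegral_countable']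
    refine tsum_congr fun w => ?_
    rw [hmass i hi]
    by_cases h : n ≤ w.length <;> simp [h]
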